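/- Let $\mathcal G=(V,E_1,\dots,E_T)$ and $\mathcal H=(W,F_1,\dots,F_U)$ with $T,U\ge 1$ be two temporal graphs with layers $G_i=(V,E_i)$, $H_j=(W,F_j)$ and $|V|=|W|=n$. Let $f_{G_i}\colon V\to\mathbb Q^k$ and $f_{H_j}\colon W\to\mathbb Q^k$ be arbitrary vertex signature functions of the layers and let $d\colon\mathbb Q^k\times\mathbb Q^k\to\mathbb Q$ be an arbitrary metric. The dynamic temporal graph warping distance is $$\mathrm{dtgw}(\mathcal G,\mathcal H)=\min_{M}\ \min_{p}\ \sum_{(i,j)\in p}C(G_i,H_j,M).$$ Here $M\subseteq V\times W$ ranges over the vertex mappings: sets of $\min(|V|,|W|)$ pairs such that each vertex occurs in at most one pair. The index $p$ ranges over the warping paths of order $T\times U$: sets $\{p_1,\dots,p_L\}$, $L\ge1$, of pairs with $p_1=(1,1)$, $p_L=(T,U)$ and $p_{\ell+1}-p_\ell\in\{(1,1),(0,1),(1,0)\}$. The cost $C(G,H,M)$ is $\sum_{(u,v)\in M}d(f_G(u),f_H(v))$ plus given deletion costs of the vertices of $V$ and $W$ that occur in no pair of $M$ (there are none when $|V|=|W|$).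 Then for all vertex signatures and all metrics, it can be decided in $O(n^2(T+U)+n^3)$ time whether $\mathrm{dtgw}(\mathcal G,\mathcal H)=0$. More precisely, there are a single program and a single constant $c$, independent of $n,T,U,k$, the graphs, the signatures and the metric, such that the program always halts with the correct answer, and does so within $c\,(n^2(T+U)+n^3)$ steps if $n\ge1$. The program runs on a unit-cost random access machine over natural and rational numbers with addition, subtraction, comparison and indirect addressing. It receives $n,T,U$, and the signatures are precomputed. The value of $d$ at any two of the given signatures is available in one step. -/

import Mathlib

open Finset

namespace DTGW

universe u v

/-! ## Temporal graphs with vertex signatures and the dtgw-distance -/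

/-- A static graph on the vertex set `V`, with its vertex signature function `sig : V → ℚ^k`
and its predefined vertex deletion costs `del : V → ℚ`. -/
structure SigGraph (V : Type u) (k : ℕ) where
  graph : SimpleGraph V
  sig : V → (Fin k → ℚ)
  del : V → ℚ

/-- A temporal graph: a sequence of at least one layer on a common vertex set. Every layer carries
its own signature function and deletion costs. -/
structure TemporalGraph (V : Type u) (k : ℕ) where
  lifetime : ℕ
  lifetime_pos : 0 < lifetime
  layer : Fin lifetime → SigGraph V k

/-- `d` is a (rational-valued) metric; nonnegativity follows from the three axioms. -/
structure IsMetric {X : Type u} (d : X → X → ℚ) : Prop where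
  eq_zero_iff : ∀ x y, d x y = 0 ↔ x = y
  symm : ∀ x y, d x y = d y x
  triangle : ∀ x y z, d x z ≤ d x y + d y z

/-- A vertex mapping: a set of `min |V| |W|` pairs in which every vertex of `V` and every vertex of
`W` occurs at most once. -/
def IsVertexMapping {V : Type u} {W : Type v} [Fintype V] [Fintype W]
    (M : Finset (V × W)) : Prop :=
  M.card = min (Fintype.card V) (Fintype.card W) ∧
    (∀ x ∈ M, ∀ y ∈ M, x.1 = y.1 → x = y) ∧ (∀ x ∈ M, ∀ y ∈ M, x.2 = y.2 → x = y)

/-- A single step of a warping path. -/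
def WarpStep {T U : ℕ} (a b : Fin T × Fin U) : Prop :=
  ((b.1 : ℕ) = a.1 + 1 ∧ (b.2 : ℕ) = a.2 + 1) ∨
    ((b.1 : ℕ) = a.1 ∧ (b.2 : ℕ) = a.2 + 1) ∨
    ((b.1 : ℕ) = a.1 + 1 ∧ (b.2 : ℕ) = a.2)

/-- `p` is the set of pairs of a warping path of order `T × U`; the layers are numbered from `0`, so
that the path runs from `(0, 0)` to `(T - 1, U - 1)`. -/
def IsWarpingPath {T U : ℕ} (p : Finset (Fin T × Fin U)) : Prop :=
  ∃ (l : List (Fin T × Fin U)) (hl : l ≠ []),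
    ((l.head hl).1 : ℕ) = 0 ∧ ((l.head hl).2 : ℕ) = 0 ∧
    ((l.getLast hl).1 : ℕ) + 1 = T ∧ ((l.getLast hl).2 : ℕ) + 1 = U ∧
    l.IsChain WarpStep ∧ ∀ x, x ∈ p ↔ x ∈ l

open Classical in
/-- The finite set of all vertex mappings between `V` and `W`. -/
noncomputable def vertexMappings (V : Type u) (W : Type v) [Fintype V] [Fintype W] :
    Finset (Finset (V × W)) :=
  univ.filter IsVertexMapping

open Classical in
/-- The finite set of all warping paths of order `T × U`. -/
noncomputable def warpingPaths (T U : ℕ) : Finset (Finset (Fin T × Fin U)) :=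
  univ.filter IsWarpingPath

theorem vertexMappings_nonempty (V : Type u) (W : Type v) [Fintype V] [Fintype W] :
    (vertexMappings V W).Nonempty := by
  classical
  rcases le_total (Fintype.card V) (Fintype.card W) with h | h
  · obtain ⟨f⟩ := Function.Embedding.nonempty_of_card_le h
    refine ⟨univ.image (fun x => (x, f x)), ?_⟩
    simp only [vertexMappings, mem_filter, mem_univ, true_and, IsVertexMapping]
    refine ⟨?_, ?_, ?_⟩
    · rw [card_image_of_injective _ (fun a b hab => (Prod.ext_iff.1 hab).1), card_univ,
        min_eq_left h]
    · simp
    · simp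
  · obtain ⟨f⟩ := Function.Embedding.nonempty_of_card_le h
    refine ⟨univ.image (fun x => (f x, x)), ?_⟩
    simp only [vertexMappings, mem_filter, mem_univ, true_and, IsVertexMapping]
    refine ⟨?_, ?_, ?_⟩
    · rw [card_image_of_injective _ (fun a b hab => (Prod.ext_iff.1 hab).2), card_univ,
        min_eq_right h]
    · simp
    · simp

theorem exists_chain {T U : ℕ} (hT : 0 < T) (hU : 0 < U) (m : ℕ) :
    ∀ a b, a + b = m → ∀ (ha : a < T) (hb : b < U),
      ∃ l : List (Fin T × Fin U), (l ++ [((⟨a, ha⟩, ⟨b, hb⟩) : Fin T × Fin U)]).IsChain WarpStep ∧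
        (l ++ [((⟨a, ha⟩, ⟨b, hb⟩) : Fin T × Fin U)]).head (by simp) = (⟨0, hT⟩, ⟨0, hU⟩) := by
  induction m with
  | zero =>
    intro a b hab ha hb
    obtain ⟨rfl, rfl⟩ : a = 0 ∧ b = 0 := by omega
    exact ⟨[], by simp, by simp⟩
  | succ m ih =>
    intro a b hab ha hb
    obtain ⟨a', b', ha', hb', hm, hs⟩ : ∃ a' b', ∃ (ha' : a' < T) (hb' : b' < U), a' + b' = m ∧
        WarpStep ((⟨a', ha'⟩, ⟨b', hb'⟩) : Fin T × Fin U) (⟨a, ha⟩, ⟨b, hb⟩) := by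
      rcases Nat.eq_zero_or_pos a with h | h
      · exact ⟨a, b - 1, ha, by omega, by omega, Or.inr (Or.inl ⟨rfl, by simp; omega⟩)⟩
      · exact ⟨a - 1, b, by omega, hb, by omega, Or.inr (Or.inr ⟨by simp; omega, rfl⟩)⟩
    obtain ⟨l, h1, h2⟩ := ih a' b' hm ha' hb'
    refine ⟨l ++ [(⟨a', ha'⟩, ⟨b', hb'⟩)], ?_, ?_⟩
    · rw [List.isChain_append]
      refine ⟨h1, by simp, ?_⟩
      simpa using hs
    · rw [List.head_append_of_ne_nil (by simp)]
      exact h2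

theorem warpingPaths_nonempty {T U : ℕ} (hT : 0 < T) (hU : 0 < U) :
    (warpingPaths T U).Nonempty := by
  classical
  obtain ⟨l, h1, h2⟩ := exists_chain hT hU _ (T - 1) (U - 1) rfl (by omega) (by omega)
  refine ⟨(l ++ [((⟨T - 1, by omega⟩, ⟨U - 1, by omega⟩) : Fin T × Fin U)]).toFinset, ?_⟩
  simp only [warpingPaths, mem_filter, mem_univ, true_and]
  refine ⟨_, by simp, by rw [h2], by rw [h2], ?_, ?_, h1, fun x => List.mem_toFinset⟩
  · simp; omega
  · simp; omega

open Classical in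
/-- The cost `C(G, H, M)` of the vertex mapping `M` between two static graphs. -/
noncomputable def mappingCost {V : Type u} {W : Type v} [Fintype V] [Fintype W] {k : ℕ}
    (d : (Fin k → ℚ) → (Fin k → ℚ) → ℚ) (G : SigGraph V k) (H : SigGraph W k)
    (M : Finset (V × W)) : ℚ :=
  ∑ x ∈ M, d (G.sig x.1) (H.sig x.2)
    + ∑ a ∈ univ \ M.image Prod.fst, G.del a
    + ∑ b ∈ univ \ M.image Prod.snd, H.del b

/-- The dynamic temporal graph warping distance: the minimum, over all vertex mappings and all
warping paths, of the total cost of the pairs of layers that are warped to each other. -/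
noncomputable def dtgw {V : Type u} {W : Type v} [Fintype V] [Fintype W] {k : ℕ}
    (d : (Fin k → ℚ) → (Fin k → ℚ) → ℚ) (G : TemporalGraph V k) (H : TemporalGraph W k) : ℚ :=
  (vertexMappings V W).inf' (vertexMappings_nonempty V W) fun M =>
    (warpingPaths G.lifetime H.lifetime).inf'
      (warpingPaths_nonempty G.lifetime_pos H.lifetime_pos) fun p =>
        ∑ x ∈ p, mappingCost d (G.layer x.1) (H.layer x.2) M

/-! ## The machine model: a structured unit-cost random access machine

The machine has two unbounded memories, one of natural numbers (counters, indices, addresses) and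
one of rational numbers, both with direct and indirect addressing. Its arithmetic is restricted to
addition and subtraction. The precomputed signatures of the two input graphs are read-only and are
accessed through the metric: one operation evaluates the metric at two signatures that are given
by their graph, layer and vertex number. -/

/-- Which of the two input temporal graphs. -/
inductive Side where
  | left : Side
  | right : Side

/-- The read-only input: `q a i x b j y` is the distance between the signature of vertex `x` in
layer `i` of graph `a` and the signature of vertex `y` in layer `j` of graph `b`. -/
abbrev DistQuery := Side → ℕ → ℕ → Side → ℕ → ℕ → ℚ

/-- The contents of the two memories. -/
structure Memory where
  nat : ℕ → ℕ
  rat : ℕ → ℚ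

/-- The elementary operations. All the arguments of type `ℕ` are addresses, except for the
constant `c` of `setN`. Below, `N` and `Q` are the two memories. -/
inductive Op where
  /-- `N[x] := c` -/
  | setN (x c : ℕ)
  /-- `N[x] := N[y]` -/
  | copyN (x y : ℕ)
  /-- `N[x] := N[y] + N[z]` -/
  | addN (x y z : ℕ)
  /-- `N[x] := max (N[y] - N[z]) 0` -/
  | subN (x y z : ℕ)
  /-- `N[x] := N[N[y]]` -/
  | loadN (x y : ℕ)
  /-- `N[N[x]] := N[y]` -/
  | storeN (x y : ℕ)
  /-- `Q[x] := c` -/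
  | setQ (x : ℕ) (c : ℚ)
  /-- `Q[x] := Q[y]` -/
  | copyQ (x y : ℕ)
  /-- `Q[x] := Q[y] + Q[z]` -/
  | addQ (x y z : ℕ)
  /-- `Q[x] := Q[y] - Q[z]` -/
  | subQ (x y z : ℕ)
  /-- `Q[x] := Q[N[y]]` -/
  | loadQ (x y : ℕ)
  /-- `Q[N[x]] := Q[y]` -/
  | storeQ (x y : ℕ)
  /-- `Q[r] :=` the distance of the signature of vertex `N[x]` in layer `N[i]` of graph `a` and the
  signature of vertex `N[y]` in layer `N[j]` of graph `b` -/
  | dist (r : ℕ) (a : Side) (i x : ℕ) (b : Side) (j y : ℕ)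

/-- Overwrite one cell of the memory of natural numbers. -/
def Memory.putN (s : Memory) (x c : ℕ) : Memory :=
  { s with nat := Function.update s.nat x c }

/-- Overwrite one cell of the memory of rational numbers. -/
def Memory.putQ (s : Memory) (x : ℕ) (c : ℚ) : Memory :=
  { s with rat := Function.update s.rat x c }

/-- The effect of an elementary operation. -/
def Op.run (q : DistQuery) (s : Memory) : Op → Memory
  | .setN x c => s.putN x c
  | .copyN x y => s.putN x (s.nat y)
  | .addN x y z => s.putN x (s.nat y + s.nat z)
  | .subN x y z => s.putN x (s.nat y - s.nat z)
  | .loadN x y => s.putN x (s.nat (s.nat y))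
  | .storeN x y => s.putN (s.nat x) (s.nat y)
  | .setQ x c => s.putQ x c
  | .copyQ x y => s.putQ x (s.rat y)
  | .addQ x y z => s.putQ x (s.rat y + s.rat z)
  | .subQ x y z => s.putQ x (s.rat y - s.rat z)
  | .loadQ x y => s.putQ x (s.rat (s.nat y))
  | .storeQ x y => s.putQ (s.nat x) (s.rat y)
  | .dist r a i x b j y => s.putQ r (q a (s.nat i) (s.nat x) b (s.nat j) (s.nat y))

/-- The elementary tests: comparisons of two memory cells. -/
inductive Cond where
  | eqN (x y : ℕ)
  | leN (x y : ℕ)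
  | eqQ (x y : ℕ)
  | leQ (x y : ℕ)

/-- The meaning of an elementary test. -/
def Cond.Holds (s : Memory) : Cond → Prop
  | .eqN x y => s.nat x = s.nat y
  | .leN x y => s.nat x ≤ s.nat y
  | .eqQ x y => s.rat x = s.rat y
  | .leQ x y => s.rat x ≤ s.rat y

/-- Programs: finite texts built from elementary operations by sequencing, branching and loops. -/
inductive Program where
  | op (o : Op)
  | seq (p r : Program)
  | ite (c : Cond) (p r : Program)
  | loop (c : Cond) (p : Program)

/-- `Exec q p s t s'`: on the read-only input `q`, the program `p`, started with the memory contents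
`s`, terminates with the memory contents `s'` after exactly `t` steps. Every elementary operation
and every evaluation of a test (of a branching, or before each iteration of a loop) is one step. -/
inductive Exec (q : DistQuery) : Program → Memory → ℕ → Memory → Prop where
  | op (o : Op) (s : Memory) : Exec q (.op o) s 1 (o.run q s)
  | seq {p r : Program} {s s' s'' : Memory} {t t' : ℕ} :
      Exec q p s t s' → Exec q r s' t' s'' → Exec q (.seq p r) s (t + t') s''
  | iteTrue {c : Cond} {p r : Program} {s s' : Memory} {t : ℕ} :
      c.Holds s → Exec q p s t s' → Exec q (.ite c p r) s (1 + t) s'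
  | iteFalse {c : Cond} {p r : Program} {s s' : Memory} {t : ℕ} :
      ¬ c.Holds s → Exec q r s t s' → Exec q (.ite c p r) s (1 + t) s'
  | loopDone {c : Cond} {p : Program} {s : Memory} :
      ¬ c.Holds s → Exec q (.loop c p) s 1 s
  | loopNext {c : Cond} {p : Program} {s s' s'' : Memory} {t t' : ℕ} :
      c.Holds s → Exec q p s t s' → Exec q (.loop c p) s' t' s'' →
        Exec q (.loop c p) s (1 + t + t') s''

/-- Execution is deterministic: the running time and the final memory are determined by the program
and the initial memory. -/
theorem Exec.unique {q : DistQuery} {p : Program} {s s₁ : Memory} {t₁ : ℕ}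
    (h : Exec q p s t₁ s₁) : ∀ {t₂ : ℕ} {s₂ : Memory}, Exec q p s t₂ s₂ → t₁ = t₂ ∧ s₁ = s₂ := by
  induction h with
  | op o s => intro _ _ h'; cases h'; exact ⟨rfl, rfl⟩
  | seq _ _ ih ih' =>
    intro _ _ h'
    cases h' with
    | seq g g' =>
      obtain ⟨rfl, rfl⟩ := ih g
      obtain ⟨rfl, rfl⟩ := ih' g'
      exact ⟨rfl, rfl⟩
  | iteTrue hc _ ih =>
    intro _ _ h'
    cases h' with
    | iteTrue _ g => obtain ⟨rfl, rfl⟩ := ih g; exact ⟨rfl, rfl⟩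
    | iteFalse hc' _ => exact absurd hc hc'
  | iteFalse hc _ ih =>
    intro _ _ h'
    cases h' with
    | iteTrue hc' _ => exact absurd hc' hc
    | iteFalse _ g => obtain ⟨rfl, rfl⟩ := ih g; exact ⟨rfl, rfl⟩
  | loopDone hc =>
    intro _ _ h'
    cases h' with
    | loopDone _ => exact ⟨rfl, rfl⟩
    | loopNext hc' _ _ => exact absurd hc' hc
  | loopNext hc _ _ ih ih' =>
    intro _ _ h'
    cases h' with
    | loopDone hc' => exact absurd hc hc'
    | loopNext _ g g' =>
      obtain ⟨rfl, rfl⟩ := ih g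
      obtain ⟨rfl, rfl⟩ := ih' g'
      exact ⟨rfl, rfl⟩

/-- The initial memory: `n`, `T`, `U` in the first three cells, and `0` everywhere else. -/
def initMemory (n T U : ℕ) : Memory where
  nat x := if x = 0 then n else if x = 1 then T else if x = 2 then U else 0
  rat _ := 0

/-- The signature of the `x`-th vertex in the `i`-th layer (both numbered from `0`), if these
numbers are in range. -/
def TemporalGraph.sigAt {V : Type u} {k n : ℕ} (G : TemporalGraph V k) (e : Fin n ≃ V)
    (i x : ℕ) : Option (Fin k → ℚ) :=
  if h : i < G.lifetime ∧ x < n then some ((G.layer ⟨i, h.1⟩).sig (e ⟨x, h.2⟩)) else none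

/-- The read-only input that belongs to the temporal graphs `G` and `H`, whose vertices are numbered
by `e` and `e'`, and to the metric `d`. A query outside the range of the input returns `0`. -/
def distQuery {V : Type u} {W : Type v} {k n : ℕ} (d : (Fin k → ℚ) → (Fin k → ℚ) → ℚ)
    (G : TemporalGraph V k) (e : Fin n ≃ V) (H : TemporalGraph W k) (e' : Fin n ≃ W) :
    DistQuery := fun a i x b j y =>
  let look : Side → ℕ → ℕ → Option (Fin k → ℚ)
    | .left, i, x => G.sigAt e i x
    | .right, i, x => H.sigAt e' i x
  match look a i x, look b j y with
  | some f, some g => d f g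
  | _, _ => 0

end DTGW

namespace DTGW

/-! The metric is nonnegative and vanishes only on equal signatures. As `|V| = |W|`, a vertex
mapping is a bijection and no deletion costs occur. Hence the distance is zero exactly if some
bijection `σ` and some warping path make the signatures of `u` and `σ u` agree in every pair of
layers on the path, for all `u` (`dtgw_eq_zero_iff`).

Fix `σ` and read each layer as one tuple of signatures. Two sequences can be warped onto each other
with equality at every pair exactly if they coincide after every run of equal consecutive entries is
shortened to one entry (`exists_isWarpingPath_iff`). Relabelling vertices does not change which
consecutive layers of one graph are equal, so the runs do not depend on `σ` and can be shortened in
each graph beforehand. What is left is to compare the two lengths and to find a bijection between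
vertices of equal colour, the colour being the list of signatures in the remaining layers
(`dtgw_eq_zero_iff_canMatch`). Since having the same colour is an equivalence, any greedy choice is
safe (`canMatch_succ_iff`), and no assignment problem has to be solved.

Shortening costs `O((n + 1)(T + U))` steps and the greedy matching `O(n^2 K + n^2 + n + 1)`, where
`K ≤ T` is the common shortened length. Equality of signature tuples is tested by summing distances
and comparing with zero. -/

/-! ## A program logic with running times -/

/-- Started in `s`, the program `p` terminates within `B` steps in a memory satisfying `Q`. -/
def Runs (q : DistQuery) (p : Program) (s : Memory) (B : ℕ) (Q : Memory → Prop) : Prop :=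
  ∃ t s', Exec q p s t s' ∧ t ≤ B ∧ Q s'

namespace Runs

variable {q : DistQuery} {p r : Program} {s : Memory} {B B' : ℕ} {Q Q' : Memory → Prop}

theorem mono (h : Runs q p s B Q) (hB : B ≤ B') (hQ : ∀ s', Q s' → Q' s') :
    Runs q p s B' Q' := by
  obtain ⟨t, s', h1, h2, h3⟩ := h
  exact ⟨t, s', h1, h2.trans hB, hQ _ h3⟩

theorem op {o : Op} (h : Q (o.run q s)) : Runs q (.op o) s 1 Q :=
  ⟨_, _, .op o s, le_rfl, h⟩

/-- The postcondition of the first program is itself a `Runs` statement, so goals are proved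
forwards along the program text. Only upper bounds on time are kept, which lets branches of
different cost share one bound. -/
theorem seq (h : Runs q p s B fun s' => Runs q r s' B' Q) :
    Runs q (.seq p r) s (B + B') Q := by
  obtain ⟨t, s', h1, h2, t', s'', h3, h4, h5⟩ := h
  exact ⟨_, _, .seq h1 h3, add_le_add h2 h4, h5⟩

theorem ite {c : Cond} (h : c.Holds s → Runs q p s B Q) (h' : ¬ c.Holds s → Runs q r s B Q) :
    Runs q (.ite c p r) s (1 + B) Q := by
  by_cases hc : c.Holds s
  · obtain ⟨t, s', h1, h2, h3⟩ := h hc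
    exact ⟨_, _, .iteTrue hc h1, by omega, h3⟩
  · obtain ⟨t, s', h1, h2, h3⟩ := h' hc
    exact ⟨_, _, .iteFalse hc h1, by omega, h3⟩

/-- A loop that counts the register `c` down to `0`. -/
theorem countdown {one c : ℕ} {I : ℕ → Memory → Prop}
    (hI : ∀ m s, I m s → s.nat one = 1 ∧ s.nat c = m)
    {N : ℕ} (hstep : ∀ m s, m < N → I (m + 1) s → Runs q p s B (I m)) :
    ∀ m s, m ≤ N → I m s → Runs q (.loop (.leN one c) p) s (m * (B + 1) + 1) (I 0) := by
  intro m
  induction m with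
  | zero =>
    intro s _ hs
    have := hI _ _ hs
    exact ⟨1, s, .loopDone (by simp [Cond.Holds, this]), by simp, hs⟩
  | succ m ih =>
    intro s hm hs
    have := hI _ _ hs
    obtain ⟨t, s', h1, h2, h3⟩ := hstep m s (by omega) hs
    obtain ⟨t', s'', h4, h5, h6⟩ := ih s' (by omega) h3
    refine ⟨_, _, .loopNext (by simp [Cond.Holds, this]) h1 h4, ?_, h6⟩
    rw [Nat.succ_mul]
    omega

end Runs

/-- A straight-line block of operations, followed by a program. -/
def Program.block (l : List Op) (p : Program) : Program :=
  l.foldr (fun o r => .seq (.op o) r) p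

theorem Runs.block {q : DistQuery} {p : Program} {B : ℕ} {Q : Memory → Prop} :
    ∀ {l : List Op} {s : Memory}, Runs q p (l.foldl (Op.run q) s) B Q →
      Runs q (.block l p) s (l.length + B) Q
  | [], _, h => by simpa [Program.block] using h
  | o :: l, s, h => by
    have := Runs.seq (r := .block l p) (Runs.op (q := q) (o := o) (s := s) (Runs.block (l := l) h))
    exact this.mono (by simp; omega) fun _ h => h

/-! ## Compressing runs of equal layers -/

/-- Register `1` of the rational memory gains the sum of the distances between the signatures of
the same vertex in the layers `N[4]` and `N[5]`. -/
def layerDistance (a : Side) : Program :=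
  .loop (.leN 3 6) (.block [.subN 6 6 3, .dist 0 a 4 6 a 5 6] (.op (.addQ 1 1 0)))

theorem layerDistance_runs (q : DistQuery) (a : Side) (s : Memory) (h1 : s.nat 3 = 1) :
    Runs q (layerDistance a) s (s.nat 6 * 4 + 1) fun s' =>
      (∀ r, r ≠ 6 → s'.nat r = s.nat r) ∧ (∀ r, r ≠ 0 → r ≠ 1 → s'.rat r = s.rat r) ∧
      s'.rat 1 = s.rat 1 + ∑ x ∈ range (s.nat 6), q a (s.nat 4) x a (s.nat 5) x := by
  have key := Runs.countdown (q := q) (one := 3) (c := 6) (N := s.nat 6) (B := 3)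
    (p := .block [.subN 6 6 3, .dist 0 a 4 6 a 5 6] (.op (.addQ 1 1 0)))
    (I := fun m s' => (∀ r, r ≠ 6 → s'.nat r = s.nat r) ∧
      (∀ r, r ≠ 0 → r ≠ 1 → s'.rat r = s.rat r) ∧ s'.nat 6 = m ∧
      -- Vertices are visited downwards, so the missing part is the sum over `range m`; accumulator
      -- plus missing part is invariant.
      s'.rat 1 + ∑ x ∈ range m, q a (s.nat 4) x a (s.nat 5) x =
        s.rat 1 + ∑ x ∈ range (s.nat 6), q a (s.nat 4) x a (s.nat 5) x)
    (by rintro m s' ⟨h, -, h', -⟩; exact ⟨by rw [h _ (by simp), h1], h'⟩)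
    (by
      rintro m s' - ⟨hn, hr, hm, hs⟩
      refine Runs.block (l := [_, _]) (B := 1) (Runs.op ?_)
      have e3 := hn 3 (by simp)
      have e4 := hn 4 (by simp)
      have e5 := hn 5 (by simp)
      simp only [List.foldl, Op.run, Memory.putN, Memory.putQ]
      refine ⟨fun r h => by simp [h, hn], fun r h0 h1 => by simp [h0, h1, hr], ?_, ?_⟩
      · simp [hm, e3, h1]
      · rw [← hs, sum_range_succ]
        simp [hm, e3, h1, e4, e5]
        ring)
    (s.nat 6) s le_rfl ⟨fun _ _ => rfl, fun _ _ _ => rfl, rfl, rfl⟩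
  refine key.mono le_rfl ?_
  rintro s' ⟨h2, h3, -, h4⟩
  exact ⟨h2, h3, by simpa using h4⟩

/-- The last layers of the runs of equal layers, in the range from `m` to `N`, where `same i` states
that the layers `i` and `i + 1` are equal. -/
noncomputable def runEnds (same : ℕ → Prop) (N m : ℕ) : List ℕ :=
  open Classical in (List.range' m (N - m)).filter (fun i => ¬ same i) ++ [N]

theorem runEnds_self (same : ℕ → Prop) (N : ℕ) : runEnds same N N = [N] := by
  simp [runEnds]

/-- These recursions go from `m + 1` down to `m`. They serve both the loop over the layers, which
counts down, and the inductions along warping paths. -/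
theorem runEnds_of_same {same : ℕ → Prop} {N m : ℕ} (h : m < N) (hs : same m) :
    runEnds same N m = runEnds same N (m + 1) := by
  obtain ⟨k, hk⟩ : ∃ k, N - m = k + 1 := ⟨N - m - 1, by omega⟩
  have hk' : N - (m + 1) = k := by omega
  simp [runEnds, hk, hk', List.range'_succ, hs]

theorem runEnds_of_not_same {same : ℕ → Prop} {N m : ℕ} (h : m < N) (hs : ¬ same m) :
    runEnds same N m = m :: runEnds same N (m + 1) := by
  obtain ⟨k, hk⟩ : ∃ k, N - m = k + 1 := ⟨N - m - 1, by omega⟩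
  have hk' : N - (m + 1) = k := by omega
  simp [runEnds, hk, hk', List.range'_succ, hs]

theorem length_runEnds_le (same : ℕ → Prop) (N m : ℕ) :
    (runEnds same N m).length ≤ N - m + 1 := by
  simpa [runEnds] using (List.length_filter_le _ (List.range' m (N - m)))

theorem le_of_mem_runEnds {same : ℕ → Prop} {N m i : ℕ} (h : i ∈ runEnds same N m) : i ≤ N := by
  simp only [runEnds, List.mem_append, List.mem_filter, List.mem_range'_1, List.mem_singleton] at h
  omega

/-- The list is stored, from its last entry to its first one, in every second cell of `f` from
address `base` on. -/
def Stored (f : ℕ → ℕ) (base : ℕ) : List ℕ → Prop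
  | [] => True
  | a :: l => f (base + 2 * l.length) = a ∧ Stored f base l

theorem Stored.congr {f g : ℕ → ℕ} {base : ℕ} : ∀ {l : List ℕ},
    (∀ i < l.length, g (base + 2 * i) = f (base + 2 * i)) → Stored f base l → Stored g base l
  | [], _, _ => trivial
  | _ :: l, h, hs => ⟨by rw [h _ (by simp)]; exact hs.1,
      hs.2.congr fun i hi => h i (by simp; omega)⟩

/-- Both lists are stored backwards, so for equal lengths the cells with the same index `i` still
hold corresponding entries. -/
theorem Stored.forall_iff {f : ℕ → ℕ} {b b' : ℕ} {R : ℕ → ℕ → Prop} : ∀ {l l' : List ℕ},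
    l.length = l'.length → Stored f b l → Stored f b' l' →
      ((∀ i < l.length, R (f (b + 2 * i)) (f (b' + 2 * i))) ↔ List.Forall₂ R l l')
  | [], [], _, _, _ => by simp
  | a :: l, a' :: l', hl, hs, hs' => by
    have hl' : l.length = l'.length := by simpa using hl
    rw [List.forall₂_cons, ← Stored.forall_iff hl' hs.2 hs'.2, List.length_cons,
      Nat.forall_lt_succ_right, and_comm, hs.1, hl', hs'.1]

/-- Store the numbers of the last layers of the runs of equal layers of one of the graphs in every
second cell from address `base` on, and their number in register `K`. -/
def compress (a : Side) (len K base : ℕ) : Program :=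
  -- The last layer always ends a run: it is stored before the loop, and the count starts at one.
  .block [.subN 4 len 3, .copyN base 4, .copyN K 3] <|
  .loop (.leN 3 4) <|
    .block [.copyN 5 4, .subN 4 4 3, .copyQ 1 2, .copyN 6 0] <|
    .seq (layerDistance a) <|
    -- The rational register `2` holds zero. Copying a cell to itself serves as the empty program.
    .ite (.eqQ 1 2) (.op (.copyN 5 5)) <|
      -- There is no multiplication; the address `base + 2 * N[K]` of the next free cell is formed
      -- by adding `N[K]` twice.
      .block [.setN 7 base, .addN 7 7 K, .addN 7 7 K, .storeN 7 4] (.op (.addN K K 3))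

/-- Apart from the scratch cells `4` to `7`, only `K` and every second cell from `base` on may
change. With bases of different parity, compressing the second graph therefore preserves the list of
the first. -/
theorem compress_runs (q : DistQuery) (a : Side) {len K base : ℕ} (s : Memory)
    (hK : 7 < K) (hb : K < base) (h1 : s.nat 3 = 1) (h2 : s.rat 2 = 0)
    (same : ℕ → Prop)
    (hsame : ∀ i < s.nat len - 1, same i ↔ ∑ x ∈ range (s.nat 0), q a i x a (i + 1) x = 0) :
    Runs q (compress a len K base) s ((s.nat len - 1) * (s.nat 0 * 4 + 12) + 4) fun s' =>
      Stored s'.nat base (runEnds same (s.nat len - 1) 0) ∧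
      s'.nat K = (runEnds same (s.nat len - 1) 0).length ∧
      (∀ r, r ≤ 3 ∨ (7 < r ∧ r ≠ K ∧ ∀ i, r ≠ base + 2 * i) → s'.nat r = s.nat r) ∧
      (∀ r, 1 < r → s'.rat r = s.rat r) := by
  set N := s.nat len - 1 with hN
  set n := s.nat 0 with hn
  let I : ℕ → Memory → Prop := fun m s' => s'.nat 4 = m ∧
      Stored s'.nat base (runEnds same N m) ∧ s'.nat K = (runEnds same N m).length ∧
      (∀ r, r ≤ 3 ∨ (7 < r ∧ r ≠ K ∧ ∀ i, r ≠ base + 2 * i) → s'.nat r = s.nat r) ∧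
      (∀ r, 1 < r → s'.rat r = s.rat r)
  have key : ∀ m s', m ≤ N → I m s' → _ := Runs.countdown (q := q) (one := 3) (c := 4) (B := n * 4 + 11)
    (p := .block [.copyN 5 4, .subN 4 4 3, .copyQ 1 2, .copyN 6 0] <|
      .seq (layerDistance a) <|
      .ite (.eqQ 1 2) (.op (.copyN 5 5)) <|
      .block [.setN 7 base, .addN 7 7 K, .addN 7 7 K, .storeN 7 4] (.op (.addN K K 3)))
    (I := I)
    (by rintro m s' ⟨h, -, -, h', -⟩; exact ⟨by rw [h' _ (by simp), h1], h⟩)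
    (by
      rintro m s' hm ⟨h4, hst, hlenK, hnat, hrat⟩
      have e0 := hnat 0 (by simp)
      have e3 := hnat 3 (by simp)
      have q2 := hrat 2 (by simp)
      have hB : n * 4 + 11 = [Op.copyN 5 4, .subN 4 4 3, .copyQ 1 2, .copyN 6 0].length +
        ((n * 4 + 1) + (1 + 5)) := by simp; omega
      rw [hB]
      refine Runs.block (Runs.seq ?_)
      set s1 := List.foldl (Op.run q) s' [Op.copyN 5 4, .subN 4 4 3, .copyQ 1 2, .copyN 6 0]
        with hs1
      simp only [List.foldl, Op.run, Memory.putN, Memory.putQ] at hs1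
      have f4 : s1.nat 4 = m := by simp [hs1, h4, e3, h1]
      have f5 : s1.nat 5 = m + 1 := by simp [hs1, h4]
      have f6 : s1.nat 6 = n := by simp [hs1, e0, hn]
      have fo : ∀ r, r ≠ 4 → r ≠ 5 → r ≠ 6 → s1.nat r = s'.nat r := by
        intro r h4 h5 h6; simp [hs1, h4, h5, h6]
      have g1 : s1.rat 1 = 0 := by simp [hs1, q2, h2]
      have go : ∀ r, r ≠ 1 → s1.rat r = s'.rat r := by
        intro r h; simp [hs1, h]
      clear_value s1
      clear hs1
      refine (layerDistance_runs q a s1 (by rw [fo 3 (by simp) (by simp) (by simp), e3, h1])).mono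
        (by rw [f6]) ?_
      rintro s2 ⟨k1, k2, k3⟩
      rw [f6, f4, f5, g1, zero_add] at k3
      have l2 : s2.rat 2 = 0 := by rw [k2 2 (by simp) (by simp), go 2 (by simp), q2, h2]
      have nat2 : ∀ r, r ≠ 4 → r ≠ 5 → r ≠ 6 → s2.nat r = s'.nat r := fun r h4 h5 h6 => by
        rw [k1 r h6, fo r h4 h5 h6]
      have rat2 : ∀ r, 1 < r → s2.rat r = s.rat r := fun r h => by
        rw [k2 r (by omega) (by omega), go r (by omega), hrat r h]
      have m4 : s2.nat 4 = m := by rw [k1 4 (by simp), f4]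
      refine Runs.ite ?_ ?_
      · intro hc
        have hsm : same m := by
          rw [hsame m hm, ← k3]; simpa [Cond.Holds, l2] using hc
        refine (Runs.op ?_).mono (by omega) fun _ h => h
        have : Op.run q s2 (.copyN 5 5) = s2 := by simp [Op.run, Memory.putN]
        rw [this]
        refine ⟨m4, ?_, ?_, ?_, rat2⟩
        · rw [runEnds_of_same hm hsm]
          exact hst.congr fun i _ => nat2 _ (by omega) (by omega) (by omega)
        · rw [runEnds_of_same hm hsm, nat2 K (by omega) (by omega) (by omega), hlenK]
        · intro r hr
          rw [nat2 r (by omega) (by omega) (by omega), hnat r hr]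
      · intro hc
        have hsm : ¬ same m := by
          rw [hsame m hm, ← k3]; simpa [Cond.Holds, l2] using hc
        have hKv : s2.nat K = (runEnds same N (m + 1)).length := by
          rw [nat2 K (by omega) (by omega) (by omega), hlenK]
        have m3 : s2.nat 3 = 1 := by rw [nat2 3 (by simp) (by simp) (by simp), e3, h1]
        refine Runs.block (l := [_, _, _, _]) (B := 1) (Runs.op ?_)
        set L := (runEnds same N (m + 1)).length with hL
        set s3 := Op.run q (List.foldl (Op.run q) s2
          [Op.setN 7 base, .addN 7 7 K, .addN 7 7 K, .storeN 7 4]) (Op.addN K K 3) with hs3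
        have hK7 : K ≠ 7 := by omega
        have hK3 : 3 ≠ K := by omega
        have hKb : K ≠ base + L + L := by omega
        have h3b : 3 ≠ base + L + L := by omega
        simp only [List.foldl, Op.run, Memory.putN, Function.update_self,
          Function.update_of_ne hK7, hKv, Function.update_of_ne hKb, Function.update_of_ne h3b] at hs3
        have r3 : ∀ r, r ≠ 7 → r ≠ K → r ≠ base + L + L → s3.nat r = s2.nat r := by
          intro r h7 hk hb; simp [hs3, h7, hk, hb]
        have rK : s3.nat K = L + 1 := by simp [hs3, m3]
        have rb : s3.nat (base + L + L) = m := by simp [hs3, m4, hKb.symm]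
        have rr : s3.rat = s2.rat := by simp [hs3]
        clear_value s3
        clear hs3
        refine ⟨?_, ?_, ?_, ?_, ?_⟩
        · rw [r3 4 (by omega) (by omega) (by omega), m4]
        · rw [runEnds_of_not_same hm hsm]
          refine ⟨by rw [← hL, two_mul, ← add_assoc, rb], hst.congr fun i hi => ?_⟩
          rw [r3 _ (by omega) (by omega) (by omega), nat2 _ (by omega) (by omega) (by omega)]
        · rw [runEnds_of_not_same hm hsm, rK, List.length_cons]
        · intro r hr
          rw [r3 r (by omega) (by omega) ?_, nat2 r (by omega) (by omega) (by omega), hnat r hr]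
          rcases hr with hr | ⟨-, -, hr⟩
          · omega
          · have := hr L; omega
        · intro r hr; rw [rr, rat2 r hr])
  have hB : N * (n * 4 + 12) + 4 =
    [Op.subN 4 len 3, .copyN base 4, .copyN K 3].length + (N * (n * 4 + 11 + 1) + 1) := by
    rw [show n * 4 + 11 + 1 = n * 4 + 12 from rfl]
    simp; omega
  rw [hB]
  refine Runs.block ((key N _ le_rfl ?_).mono le_rfl fun s' h => h.2)
  have hb3 : 3 ≠ base := by omega
  have hb4 : 4 ≠ base := by omega
  have hK4 : 4 ≠ K := by omega
  have hKb : base ≠ K := by omega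
  simp only [List.foldl, Op.run, Memory.putN, Function.update_self,
    Function.update_of_ne (show (3:ℕ) ≠ 4 by simp), h1, Function.update_of_ne hb3, ← hN, I,
    runEnds_self]
  refine ⟨?_, ?_, ?_, ?_, ?_⟩
  · simp [hK4, hb4]
  · simp [Stored, hKb]
  · simp
  · intro r hr
    have : r ≠ base := by
      rcases hr with hr | ⟨-, -, hr⟩
      · omega
      · simpa using hr 0
    have h4 : r ≠ 4 := by omega
    have h5 : r ≠ K := by omega
    simp [this, h4, h5]
  · simp

/-! ## Warping paths and runs of equal entries -/

/-- A list `l` that is a warping path from `(i, j)` to `(N, N')`, with `R` at all its pairs. -/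
def IsWarpFrom (R : ℕ → ℕ → Prop) (N N' i j : ℕ) (l : List (ℕ × ℕ)) : Prop :=
  l.head? = some (i, j) ∧ l.getLast? = some (N, N') ∧
    l.IsChain (fun a b => b = (a.1 + 1, a.2 + 1) ∨ b = (a.1, a.2 + 1) ∨ b = (a.1 + 1, a.2)) ∧
    ∀ x ∈ l, R x.1 x.2

/-- The first run keeps a representative, and all its entries have the value `g m`. -/
theorem runEnds_map_head {X : Type*} (g : ℕ → X) (N m : ℕ) (h : m ≤ N) :
    ∃ l, (runEnds (fun i => g i = g (i + 1)) N m).map g = g m :: l := by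
  induction h using Nat.decreasingInduction with
  | self => exact ⟨[], by simp [runEnds_self]⟩
  | of_succ m hm ih =>
    obtain ⟨l, hl⟩ := ih
    by_cases hs : g m = g (m + 1)
    · exact ⟨l, by rw [runEnds_of_same hm hs, hl, hs]⟩
    · exact ⟨g (m + 1) :: l, by rw [runEnds_of_not_same hm hs, List.map_cons, hl]⟩

/-- Induction along the path. At a diagonal step `g` changes exactly if `h` does, since the values
agree before and after it. At any other step one index stays fixed, which forces the moving sequence
to keep its value, so its shortened list is unchanged. -/
theorem runEnds_map_eq_of_isWarpFrom {X : Type*} {g h : ℕ → X} {N N' : ℕ} :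
    ∀ (l : List (ℕ × ℕ)) {i j : ℕ}, IsWarpFrom (fun a b => g a = h b) N N' i j l →
      i ≤ N ∧ j ≤ N' ∧ (runEnds (fun i => g i = g (i + 1)) N i).map g =
        (runEnds (fun i => h i = h (i + 1)) N' j).map h := by
  intro l
  induction l with
  | nil => intro i j hw; simp [IsWarpFrom] at hw
  | cons x l ih =>
    rintro i j ⟨h1, h2, h3, h4⟩
    obtain rfl : x = (i, j) := by simpa using h1
    have hij : g i = h j := h4 (i, j) (by simp)
    cases l with
    | nil =>
      simp only [List.getLast?_singleton, Option.some.injEq, Prod.mk.injEq] at h2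
      obtain ⟨rfl, rfl⟩ := h2
      simp [runEnds_self, hij]
    | cons y l =>
      rw [List.isChain_cons_cons] at h3
      have hw : IsWarpFrom (fun a b => g a = h b) N N' y.1 y.2 (y :: l) :=
        ⟨by simp, by simpa using h2, h3.2, fun z hz => h4 z (List.mem_cons_of_mem _ hz)⟩
      have hy : g y.1 = h y.2 := hw.2.2.2 y (by simp)
      obtain ⟨e1, e2, e3⟩ := ih hw
      rcases h3.1 with rfl | rfl | rfl <;> dsimp only at *
      · refine ⟨by omega, by omega, ?_⟩
        by_cases hs : g i = g (i + 1)
        · have hs' : h j = h (j + 1) := by rw [← hij, hs, hy]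
          rw [runEnds_of_same e1 hs, runEnds_of_same e2 hs', e3]
        · have hs' : ¬ h j = h (j + 1) := by rwa [← hij, ← hy]
          rw [runEnds_of_not_same e1 hs, runEnds_of_not_same e2 hs', List.map_cons, List.map_cons,
            e3, hij]
      · have hs' : h j = h (j + 1) := by rw [← hij, hy]
        exact ⟨e1, by omega, by rw [e3, runEnds_of_same e2 hs']⟩
      · have hs : g i = g (i + 1) := by rw [hij, hy]
        exact ⟨by omega, e2, by rw [← e3, runEnds_of_same e1 hs]⟩

theorem isWarpFrom_cons {R : ℕ → ℕ → Prop} {N N' i j i' j' : ℕ} {l : List (ℕ × ℕ)}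
    (hw : IsWarpFrom R N N' i' j' l) (hR : R i j)
    (hs : (i', j') = (i + 1, j + 1) ∨ (i', j') = (i, j + 1) ∨ (i', j') = (i + 1, j)) :
    IsWarpFrom R N N' i j ((i, j) :: l) := by
  obtain ⟨h1, h2, h3, h4⟩ := hw
  cases l with
  | nil => simp at h1
  | cons x l =>
    obtain rfl : x = (i', j') := by simpa using h1
    refine ⟨by simp, by simpa using h2, List.isChain_cons_cons.2 ⟨hs, h3⟩, ?_⟩
    intro x hx
    rcases List.mem_cons.1 hx with rfl | hx
    · exact hR
    · exact h4 x hx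

/-- The path is built greedily: a sequence that is inside a run advances alone, and two sequences at
the ends of runs advance together. The induction is on the number of layers left in both. -/
theorem exists_isWarpFrom_of_runEnds_map_eq {X : Type*} {g h : ℕ → X} {N N' : ℕ} (k : ℕ) :
    ∀ {i j : ℕ}, i ≤ N → j ≤ N' → (N - i) + (N' - j) = k →
      (runEnds (fun i => g i = g (i + 1)) N i).map g =
        (runEnds (fun i => h i = h (i + 1)) N' j).map h →
      ∃ l, IsWarpFrom (fun a b => g a = h b) N N' i j l := by
  induction k using Nat.strong_induction_on with
  | _ k ih =>
    intro i j hi hj hk he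
    obtain ⟨l, hl⟩ := runEnds_map_head g N i hi
    obtain ⟨l', hl'⟩ := runEnds_map_head h N' j hj
    have hij : g i = h j := by
      rw [hl, hl'] at he; exact (List.cons.inj he).1
    by_cases hA : i < N ∧ g i = g (i + 1)
    · rw [runEnds_of_same hA.1 hA.2] at he
      obtain ⟨p, hp⟩ := ih _ (by omega) (by omega) hj rfl he
      exact ⟨_, isWarpFrom_cons hp hij (by simp)⟩
    by_cases hB : j < N' ∧ h j = h (j + 1)
    · rw [runEnds_of_same hB.1 hB.2] at he
      obtain ⟨p, hp⟩ := ih _ (by omega) hi (by omega) rfl he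
      exact ⟨_, isWarpFrom_cons hp hij (by simp)⟩
    -- Both indices are now at ends of runs. If just one of them is at its final layer, one list has
    -- a single entry and the other at least two, contradicting `he`.
    rcases hi.lt_or_eq with hi' | rfl <;> rcases hj.lt_or_eq with hj' | rfl
    · rw [runEnds_of_not_same hi' (fun h => hA ⟨hi', h⟩),
        runEnds_of_not_same hj' (fun h => hB ⟨hj', h⟩)] at he
      obtain ⟨p, hp⟩ := ih _ (by omega) (by omega) (by omega) rfl (List.cons.inj he).2
      exact ⟨_, isWarpFrom_cons hp hij (by simp)⟩
    · obtain ⟨l'', hl''⟩ := runEnds_map_head g N (i + 1) hi'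
      rw [runEnds_of_not_same hi' (fun h => hA ⟨hi', h⟩), runEnds_self, List.map_cons, hl''] at he
      simp at he
    · obtain ⟨l'', hl''⟩ := runEnds_map_head h N' (j + 1) hj'
      rw [runEnds_of_not_same hj' (fun h => hB ⟨hj', h⟩), runEnds_self, List.map_cons,
        List.map_cons, hl''] at he
      simp at he
    · exact ⟨[(i, j)], by simp, by simp, by simp, by simpa using hij⟩

theorem exists_isWarpingPath_iff {X : Type*} {g h : ℕ → X} {T U : ℕ} (hT : 0 < T) (hU : 0 < U) :
    (∃ p : Finset (Fin T × Fin U), IsWarpingPath p ∧ ∀ x ∈ p, g x.1 = h x.2) ↔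
      (runEnds (fun i => g i = g (i + 1)) (T - 1) 0).map g =
        (runEnds (fun i => h i = h (i + 1)) (U - 1) 0).map h := by
  classical
  constructor
  · rintro ⟨p, ⟨l, hl, h1, h2, h3, h4, h5, h6⟩, hp⟩
    refine (runEnds_map_eq_of_isWarpFrom
      (l.map fun x : Fin T × Fin U => ((x.1 : ℕ), (x.2 : ℕ))) ⟨?_, ?_, ?_, ?_⟩).2.2
    · rw [List.head?_map, List.head?_eq_some_head hl]
      simp [h1, h2]
    · rw [List.getLast?_map, List.getLast?_eq_some_getLast hl]
      simp; omega
    · rw [List.isChain_map]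
      refine h5.imp fun a b hab => ?_
      simpa [WarpStep, Prod.ext_iff] using hab
    · intro x hx
      obtain ⟨y, hy, rfl⟩ := List.mem_map.1 hx
      exact hp y ((h6 y).2 hy)
  · intro he
    obtain ⟨l, h1, h2, h3, h4⟩ := exists_isWarpFrom_of_runEnds_map_eq _ (Nat.zero_le _)
      (Nat.zero_le _) rfl he
    -- Returning to `Fin` needs all pairs in range. Every nonempty suffix of the path is again a
    -- warping path to the same end, so the bounds on starting points apply to each pair.
    have hbound : ∀ (l : List (ℕ × ℕ)) i j, IsWarpFrom (fun a b => g a = h b) (T - 1) (U - 1) i j l →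
        ∀ x ∈ l, x.1 < T ∧ x.2 < U := by
      intro l
      induction l with
      | nil => simp
      | cons y l ih =>
        rintro i j hw x hx
        have hb := runEnds_map_eq_of_isWarpFrom _ hw
        obtain ⟨g1, g2, g3, g4⟩ := hw
        obtain rfl : y = (i, j) := by simpa using g1
        rcases List.mem_cons.1 hx with rfl | hx
        · exact ⟨by have := hb.1; simp; omega, by have := hb.2.1; simp; omega⟩
        · cases l with
          | nil => simp at hx
          | cons z l =>
            exact ih z.1 z.2 ⟨by simp, by simpa using g2, (List.isChain_cons_cons.1 g3).2,
              fun w hw => g4 w (List.mem_cons_of_mem _ hw)⟩ x hx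
    have hb := hbound l 0 0 ⟨h1, h2, h3, h4⟩
    obtain ⟨l', rfl⟩ : ∃ l' : List (Fin T × Fin U), l'.map (fun x => ((x.1 : ℕ), (x.2 : ℕ))) = l :=
      ⟨l.pmap (fun x hx => (⟨x.1, hx.1⟩, ⟨x.2, hx.2⟩)) hb, by simp [List.map_pmap]⟩
    have hl : l' ≠ [] := by rintro rfl; simp at h1
    rw [List.head?_map, List.head?_eq_some_head hl] at h1
    rw [List.getLast?_map, List.getLast?_eq_some_getLast hl] at h2
    rw [List.isChain_map] at h3
    simp only [Option.map_some, Option.some.injEq, Prod.mk.injEq] at h1 h2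
    refine ⟨l'.toFinset, ⟨l', hl, h1.1, h1.2, by omega, by omega, h3.imp fun a b hab => ?_,
      fun x => List.mem_toFinset⟩, fun x hx => ?_⟩
    · simpa [WarpStep, Prod.ext_iff] using hab
    · exact h4 _ (List.mem_map.2 ⟨x, List.mem_toFinset.1 hx, rfl⟩)

/-! ## Greedy matching of equal colours -/

/-- The elements below `m` can be matched to distinct free elements below `n` of the same colour. -/
def CanMatch {X : Type*} (α β : ℕ → X) (n : ℕ) (free : ℕ → Prop) (m : ℕ) : Prop :=
  ∃ f : ℕ → ℕ, (∀ u < m, f u < n ∧ free (f u) ∧ α u = β (f u)) ∧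
    ∀ u < m, ∀ v < m, f u = f v → u = v

theorem CanMatch.exists_last {X : Type*} {α β : ℕ → X} {n m : ℕ} {free : ℕ → Prop}
    (h : CanMatch α β n free (m + 1)) : ∃ v < n, free v ∧ α m = β v := by
  obtain ⟨f, hf, -⟩ := h
  exact ⟨f m, hf m (by omega)⟩

/-- Exchange argument: if a matching sends some `u` to `v`, redirect `u` to the partner of `m`. This
is allowed because `u`, `v`, `m` and that partner all have the same colour. -/
theorem canMatch_succ_iff {X : Type*} {α β : ℕ → X} {n m v : ℕ} {free : ℕ → Prop}
    (hv : v < n) (hfree : free v) (hc : α m = β v) :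
    CanMatch α β n free (m + 1) ↔ CanMatch α β n (fun w => free w ∧ w ≠ v) m := by
  constructor
  · rintro ⟨f, hf, hinj⟩
    refine ⟨fun u => if f u = v then f m else f u, fun u hu => ?_, fun u hu w hw => ?_⟩
    · obtain ⟨h1, h2, h3⟩ := hf u (by omega)
      obtain ⟨h4, h5, h6⟩ := hf m (by omega)
      by_cases h : f u = v
      · simp only [h, if_true]
        refine ⟨h4, ⟨h5, fun h' => ?_⟩, by rw [h3, h, ← hc, h6]⟩
        have := hinj u (by omega) m (by omega) (h.trans h'.symm)
        omega
      · simp only [h, if_false]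
        exact ⟨h1, ⟨h2, h⟩, h3⟩
    · have i1 := hinj u (by omega) w (by omega)
      have i2 := hinj u (by omega) m (by omega)
      have i3 := hinj w (by omega) m (by omega)
      dsimp only
      split_ifs with a b b
      · exact fun _ => i1 (a.trans b.symm)
      · intro h; have := i3 h.symm; omega
      · intro h; have := i2 h; omega
      · exact i1
  · rintro ⟨f, hf, hinj⟩
    refine ⟨fun u => if u = m then v else f u, fun u hu => ?_, fun u hu w hw => ?_⟩
    · by_cases h : u = m
      · subst h; simp [hv, hfree, hc]
      · obtain ⟨h1, ⟨h2, -⟩, h3⟩ := hf u (by omega)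
        simp [h, h1, h2, h3]
    · dsimp only
      split_ifs with a b b
      · intro _; omega
      · intro h; exact absurd h.symm (hf w (by omega)).2.1.2
      · intro h; exact absurd h (hf u (by omega)).2.1.2
      · exact hinj u (by omega) w (by omega)

theorem CanMatch.congr {X : Type*} {α β : ℕ → X} {n m : ℕ} {free free' : ℕ → Prop}
    (h : ∀ v < n, free v ↔ free' v) : CanMatch α β n free m ↔ CanMatch α β n free' m := by
  refine exists_congr fun f => and_congr_left fun _ => forall₂_congr fun u _ => ?_
  exact ⟨fun ⟨a, b, c⟩ => ⟨a, (h _ a).1 b, c⟩, fun ⟨a, b, c⟩ => ⟨a, (h _ a).2 b, c⟩⟩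

theorem canMatch_iff_exists_perm {X : Type*} {α β : ℕ → X} {n : ℕ} :
    CanMatch α β n (fun _ => True) n ↔
      ∃ σ : Equiv.Perm (Fin n), ∀ u : Fin n, α u = β (σ u) := by
  constructor
  · rintro ⟨f, hf, hinj⟩
    have hi : Function.Injective (fun u : Fin n => (⟨f u, (hf u u.2).1⟩ : Fin n)) := by
      intro u v huv
      exact Fin.ext (hinj u u.2 v v.2 (by simpa using huv))
    exact ⟨Equiv.ofBijective _ (Finite.injective_iff_bijective.1 hi), fun u => (hf u u.2).2.2⟩
  · rintro ⟨σ, hσ⟩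
    -- The value `0` outside the range is never inspected.
    refine ⟨fun u => if h : u < n then σ ⟨u, h⟩ else 0, fun u hu => ?_, fun u hu v hv huv => ?_⟩
    · simpa [hu] using hσ ⟨u, hu⟩
    · simpa [hu, hv, Fin.val_inj] using huv

/-! ## Greedy matching of the vertices -/

/-- Register `1` of the rational memory gains the sum of the distances between vertex `N[11]` of the
left graph and vertex `N[12]` of the right graph in the first `N[13]` stored pairs of layers. -/
def columnDistance : Program :=
  -- The lists of the two graphs are interleaved: the pair `i` occupies the cells `32 + 2 * i` and
  -- `33 + 2 * i`.
  .loop (.leN 3 13) (.block [.subN 13 13 3, .setN 7 32, .addN 7 7 13, .addN 7 7 13, .loadN 14 7,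
    .addN 7 7 3, .loadN 15 7, .dist 0 .left 14 11 .right 15 12] (.op (.addQ 1 1 0)))

theorem columnDistance_runs (q : DistQuery) (s : Memory) (h1 : s.nat 3 = 1) :
    Runs q columnDistance s (s.nat 13 * 10 + 1) fun s' =>
      (∀ r, r ≠ 7 → r ≠ 13 → r ≠ 14 → r ≠ 15 → s'.nat r = s.nat r) ∧
      (∀ r, 1 < r → s'.rat r = s.rat r) ∧
      s'.rat 1 = s.rat 1 + ∑ i ∈ range (s.nat 13),
        q .left (s.nat (32 + 2 * i)) (s.nat 11) .right (s.nat (33 + 2 * i)) (s.nat 12) := by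
  have key := Runs.countdown (q := q) (one := 3) (c := 13) (N := s.nat 13) (B := 9)
    (p := .block [.subN 13 13 3, .setN 7 32, .addN 7 7 13, .addN 7 7 13, .loadN 14 7,
      .addN 7 7 3, .loadN 15 7, .dist 0 .left 14 11 .right 15 12] (.op (.addQ 1 1 0)))
    (I := fun m s' => (∀ r, r ≠ 7 → r ≠ 13 → r ≠ 14 → r ≠ 15 → s'.nat r = s.nat r) ∧
      (∀ r, 1 < r → s'.rat r = s.rat r) ∧ s'.nat 13 = m ∧
      s'.rat 1 + ∑ i ∈ range m,
        q .left (s.nat (32 + 2 * i)) (s.nat 11) .right (s.nat (33 + 2 * i)) (s.nat 12) =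
        s.rat 1 + ∑ i ∈ range (s.nat 13),
          q .left (s.nat (32 + 2 * i)) (s.nat 11) .right (s.nat (33 + 2 * i)) (s.nat 12))
    (by
      rintro m s' ⟨h, -, h', -⟩
      exact ⟨by rw [h _ (by simp) (by simp) (by simp) (by simp), h1], h'⟩)
    (by
      rintro m s' - ⟨hn, hr, hm, hs⟩
      refine Runs.block (l := [_, _, _, _, _, _, _, _]) (B := 1) (Runs.op ?_)
      have e3 := hn 3 (by simp) (by simp) (by simp) (by simp)
      have e11 := hn 11 (by simp) (by simp) (by simp) (by simp)
      have e12 := hn 12 (by simp) (by simp) (by simp) (by simp)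
      have ea := hn (32 + 2 * m) (by omega) (by omega) (by omega) (by omega)
      have eb := hn (33 + 2 * m) (by omega) (by omega) (by omega) (by omega)
      have a1 : 32 + m + m = 32 + 2 * m := by omega
      have a2 : 32 + 2 * m + 1 = 33 + 2 * m := by omega
      have b1 : 32 + 2 * m ≠ 7 := by omega
      have b2 : 32 + 2 * m ≠ 13 := by omega
      have b3 : 33 + 2 * m ≠ 7 := by omega
      have b4 : 33 + 2 * m ≠ 13 := by omega
      have b5 : 33 + 2 * m ≠ 14 := by omega
      simp only [List.foldl, Op.run, Memory.putN, Memory.putQ]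
      refine ⟨fun r h7 h13 h14 h15 => by simp [h7, h13, h14, h15, hn],
        fun r h => by simp [hr _ h, show r ≠ 0 by omega, show r ≠ 1 by omega], ?_, ?_⟩
      · simp [hm, e3, h1]
      · rw [← hs, sum_range_succ]
        simp [hm, e3, h1, e11, e12, a1, a2, b1, b2, b3, b4, b5, ea, eb]
        ring)
    (s.nat 13) s le_rfl ⟨fun _ _ _ _ _ => rfl, fun _ _ => rfl, rfl, rfl⟩
  refine key.mono le_rfl ?_
  rintro s' ⟨h2, h3, -, h4⟩
  exact ⟨h2, h3, by simpa using h4⟩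

/-- Match vertex `N[11]` of the left graph to an unused vertex of the right graph with the same
signatures in the stored pairs of layers, if there is one. Used vertices `v` are marked by `1` in
the cells `8 + v` of the rational memory. -/
def matchVertex : Program :=
  .loop (.leN 3 12) <|
    -- The accumulator starts with the mark of the candidate plus the flag `Q[3]`, which is `1` once
    -- a partner has been found. All summands are nonnegative, so one comparison with zero tests
    -- that the candidate is unused, that no partner was found before, and that the colours agree.
    .block [.subN 12 12 3, .addN 7 12 17, .loadQ 1 7, .addQ 1 1 3, .copyN 13 8] <|
    .seq columnDistance <|
    .ite (.eqQ 1 2) (.block [.copyQ 3 4, .addN 7 12 17, .storeQ 7 4] (.op (.addN 16 16 3)))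
      (.op (.copyN 13 13))

/-- The constants that the matching of the vertices depends on, and the stored pairs of layers:
columns `u` and `v` agree if and only if `α u = β v`. -/
structure Ready {X : Type*} (q : DistQuery) (α β : ℕ → X) (n K : ℕ) (s : Memory) : Prop where
  nat_zero : s.nat 0 = n
  nat_three : s.nat 3 = 1
  nat_eight : s.nat 8 = K
  nat_seventeen : s.nat 17 = 8
  rat_two : s.rat 2 = 0
  rat_four : s.rat 4 = 1
  nonneg : ∀ u v, 0 ≤ ∑ i ∈ range K,
    q .left (s.nat (32 + 2 * i)) u .right (s.nat (33 + 2 * i)) v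
  eq_zero_iff : ∀ u < n, ∀ v < n, ∑ i ∈ range K,
    q .left (s.nat (32 + 2 * i)) u .right (s.nat (33 + 2 * i)) v = 0 ↔ α u = β v

theorem Ready.congr {X : Type*} {q : DistQuery} {α β : ℕ → X} {n K : ℕ} {s s' : Memory}
    (h : Ready q α β n K s)
    (hn : ∀ r, r ≠ 7 → r ≠ 11 → r ≠ 12 → r ≠ 13 → r ≠ 14 → r ≠ 15 → r ≠ 16 → s'.nat r = s.nat r)
    (h2 : s'.rat 2 = s.rat 2) (h4 : s'.rat 4 = s.rat 4) : Ready q α β n K s' := by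
  have hA : ∀ i, s'.nat (32 + 2 * i) = s.nat (32 + 2 * i) := fun i =>
    hn _ (by omega) (by omega) (by omega) (by omega) (by omega) (by omega) (by omega)
  have hB : ∀ i, s'.nat (33 + 2 * i) = s.nat (33 + 2 * i) := fun i =>
    hn _ (by omega) (by omega) (by omega) (by omega) (by omega) (by omega) (by omega)
  obtain ⟨a, b, c, d, e, f, g, k⟩ := h
  constructor
  · rw [hn 0 (by simp) (by simp) (by simp) (by simp) (by simp) (by simp) (by simp), a]
  · rw [hn 3 (by simp) (by simp) (by simp) (by simp) (by simp) (by simp) (by simp), b]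
  · rw [hn 8 (by simp) (by simp) (by simp) (by simp) (by simp) (by simp) (by simp), c]
  · rw [hn 17 (by simp) (by simp) (by simp) (by simp) (by simp) (by simp) (by simp), d]
  · rw [h2, e]
  · rw [h4, f]
  · simpa only [hA, hB] using g
  · simpa only [hA, hB] using k

theorem matchVertex_runs {X : Type*} {q : DistQuery} {α β : ℕ → X} {n K : ℕ} {s : Memory}
    (hs : Ready q α β n K s) (h12 : s.nat 12 = n) (h11 : s.nat 11 < n) (h3 : s.rat 3 = 0)
    (hpos : ∀ v, 0 ≤ s.rat (8 + v)) :
    Runs q matchVertex s (n * (K * 10 + 12) + 1) fun s' =>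
      Ready q α β n K s' ∧ s'.nat 11 = s.nat 11 ∧
      ((s'.nat 16 = s.nat 16 ∧ (∀ v, s'.rat (8 + v) = s.rat (8 + v)) ∧
          ∀ v < n, s.rat (8 + v) = 0 → α (s.nat 11) ≠ β v) ∨
        (s'.nat 16 = s.nat 16 + 1 ∧ ∃ v₀ < n, s.rat (8 + v₀) = 0 ∧ α (s.nat 11) = β v₀ ∧
          ∀ v, s'.rat (8 + v) = if v = v₀ then 1 else s.rat (8 + v))) := by
  -- The candidates from `w` on have been tried. Either none of them was suitable, or the flag is
  -- set and exactly one new mark has been made.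
  let I : ℕ → Memory → Prop := fun w s' =>
    Ready q α β n K s' ∧ s'.nat 12 = w ∧ s'.nat 11 = s.nat 11 ∧
      ((s'.rat 3 = 0 ∧ s'.nat 16 = s.nat 16 ∧ (∀ v, s'.rat (8 + v) = s.rat (8 + v)) ∧
          ∀ v < n, w ≤ v → s.rat (8 + v) = 0 → α (s.nat 11) ≠ β v) ∨
        (s'.rat 3 = 1 ∧ s'.nat 16 = s.nat 16 + 1 ∧
          ∃ v₀ < n, s.rat (8 + v₀) = 0 ∧ α (s.nat 11) = β v₀ ∧
            ∀ v, s'.rat (8 + v) = if v = v₀ then 1 else s.rat (8 + v)))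
  have key : ∀ m s', m ≤ n → I m s' → _ := Runs.countdown (q := q) (one := 3) (c := 12)
    (B := K * 10 + 11)
    (p := .block [.subN 12 12 3, .addN 7 12 17, .loadQ 1 7, .addQ 1 1 3, .copyN 13 8] <|
      .seq columnDistance <|
      .ite (.eqQ 1 2) (.block [.copyQ 3 4, .addN 7 12 17, .storeQ 7 4] (.op (.addN 16 16 3)))
        (.op (.copyN 13 13)))
    (I := I) (fun m s' h => ⟨h.1.nat_three, h.2.1⟩)
    (by
      rintro w s' hw ⟨hr, hw12, hw11, hcase⟩
      have hB : K * 10 + 11 =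
        [Op.subN 12 12 3, .addN 7 12 17, .loadQ 1 7, .addQ 1 1 3, .copyN 13 8].length +
          ((K * 10 + 1) + (1 + 4)) := by simp; omega
      rw [hB]
      refine Runs.block (Runs.seq ?_)
      set s1 := List.foldl (Op.run q) s'
        [Op.subN 12 12 3, .addN 7 12 17, .loadQ 1 7, .addQ 1 1 3, .copyN 13 8] with hs1
      simp only [List.foldl, Op.run, Memory.putN, Memory.putQ] at hs1
      have f12 : s1.nat 12 = w := by simp [hs1, hw12, hr.nat_three]
      have f13 : s1.nat 13 = K := by simp [hs1, hr.nat_eight]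
      have fo : ∀ r, r ≠ 7 → r ≠ 12 → r ≠ 13 → s1.nat r = s'.nat r := by
        intro r h7 h12 h13; simp [hs1, h7, h12, h13]
      have g1 : s1.rat 1 = s'.rat (8 + w) + s'.rat 3 := by
        simp [hs1, hw12, hr.nat_three, hr.nat_seventeen, add_comm w 8]
      have go : ∀ r, r ≠ 1 → s1.rat r = s'.rat r := by
        intro r h; simp [hs1, h]
      clear_value s1
      clear hs1
      have hr1 : Ready q α β n K s1 := hr.congr
        (fun r h7 _ h12 h13 _ _ _ => fo r h7 h12 h13) (go 2 (by simp)) (go 4 (by simp))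
      refine (columnDistance_runs q s1 hr1.nat_three).mono (by rw [f13]) ?_
      rintro s2 ⟨k1, k2, k3⟩
      have hr2 : Ready q α β n K s2 := hr1.congr
        (fun r h7 _ _ h13 h14 h15 _ => k1 r h7 h13 h14 h15) (k2 2 (by simp)) (k2 4 (by simp))
      have m11 : s2.nat 11 = s.nat 11 := by
        rw [k1 11 (by simp) (by simp) (by simp) (by simp), fo 11 (by simp) (by simp) (by simp),
          hw11]
      have m12 : s2.nat 12 = w := by
        rw [k1 12 (by simp) (by simp) (by simp) (by simp), f12]
      have m16 : s2.nat 16 = s'.nat 16 := by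
        rw [k1 16 (by simp) (by simp) (by simp) (by simp), fo 16 (by simp) (by simp) (by simp)]
      have rat2 : ∀ r, 1 < r → s2.rat r = s'.rat r := fun r h => by
        rw [k2 r h, go r (by omega)]
      have e11 : s1.nat 11 = s.nat 11 := by rw [fo 11 (by simp) (by simp) (by simp), hw11]
      rw [f13, g1, e11, f12] at k3
      have hnn := hr1.nonneg (s.nat 11) w
      have hz := hr1.eq_zero_iff (s.nat 11) h11 w hw
      set S := ∑ i ∈ range K, q .left (s1.nat (32 + 2 * i)) (s.nat 11) .right
        (s1.nat (33 + 2 * i)) w with hS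
      have hcond : (Cond.eqQ 1 2).Holds s2 ↔ s'.rat (8 + w) + s'.rat 3 + S = 0 := by
        simp [Cond.Holds, k3, hr2.rat_two]
      refine Runs.ite ?_ ?_
      · rw [hcond]
        intro hc
        refine Runs.block (l := [_, _, _]) (B := 1) (Runs.op ?_)
        set s3 := Op.run q (List.foldl (Op.run q) s2
          [Op.copyQ 3 4, .addN 7 12 17, .storeQ 7 4]) (Op.addN 16 16 3) with hs3
        simp only [List.foldl, Op.run, Memory.putN, Memory.putQ] at hs3
        have n3 : ∀ r, r ≠ 7 → r ≠ 16 → s3.nat r = s2.nat r := by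
          intro r h h'; simp [hs3, h, h']
        have n16 : s3.nat 16 = s2.nat 16 + 1 := by simp [hs3, hr2.nat_three]
        have t3 : s3.rat 3 = 1 := by
          simp [hs3, m12, hr2.nat_seventeen, hr2.rat_four]
        have tv : ∀ v, s3.rat (8 + v) = if v = w then 1 else s2.rat (8 + v) := by
          intro v
          have : 8 + v ≠ 3 := by omega
          have h' : 8 + v = w + 8 ↔ v = w := by omega
          simp [hs3, Function.update_apply, m12, hr2.nat_seventeen, hr2.rat_four, this, h']
        have tr : ∀ r, r ≠ 3 → r < 8 → s3.rat r = s2.rat r := by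
          intro r h h'
          have : r ≠ w + 8 := by omega
          simp [hs3, m12, hr2.nat_seventeen, h, this]
        clear_value s3
        clear hs3
        refine ⟨hr2.congr (fun r h7 _ _ _ _ _ h16 => n3 r h7 h16) (tr 2 (by simp) (by simp))
          (tr 4 (by simp) (by simp)), by rw [n3 12 (by simp) (by simp), m12],
          by rw [n3 11 (by simp) (by simp), m11], Or.inr ⟨t3, ?_⟩⟩
        rcases hcase with ⟨c1, c2, c3, c4⟩ | ⟨c1, c2, v₀, c3, c4, c5, c6⟩
        · have hp := hpos w
          rw [c1, c3 w] at hc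
          refine ⟨by rw [n16, m16, c2], w, hw, by linarith, hz.1 (by linarith), fun v => ?_⟩
          rw [tv, rat2 _ (by omega), c3]
        -- With the flag set the tested sum is at least `1`, so a second match is impossible.
        · have : 0 ≤ s'.rat (8 + w) := by
            rw [c6 w]; split_ifs
            · simp
            · exact hpos w
          rw [c1] at hc
          linarith
      · rw [hcond]
        intro hc
        refine (Runs.op ?_).mono (by omega) fun _ h => h
        have : Op.run q s2 (.copyN 13 13) = s2 := by simp [Op.run, Memory.putN]
        rw [this]
        refine ⟨hr2, m12, m11, ?_⟩
        rcases hcase with ⟨c1, c2, c3, c4⟩ | ⟨c1, c2, v₀, c3, c4, c5, c6⟩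
        · refine Or.inl ⟨by rw [rat2 3 (by simp), c1], by rw [m16, c2],
            fun v => by rw [rat2 _ (by omega), c3], fun v hv hwv h0 => ?_⟩
          rcases hwv.eq_or_lt with rfl | hwv
          · intro he
            rw [c1, c3, h0, hz.2 he] at hc
            simp at hc
          · exact c4 v hv hwv h0
        · exact Or.inr ⟨by rw [rat2 3 (by simp), c1], by rw [m16, c2], v₀, c3, c4, c5,
            fun v => by rw [rat2 _ (by omega), c6]⟩)
  refine (key n s le_rfl ⟨hs, h12, rfl, Or.inl ⟨h3, rfl, fun _ => rfl, fun v hv h => by omega⟩⟩).mono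
    le_rfl ?_
  rintro s' ⟨hr, -, h11', ⟨-, c2, c3, c4⟩ | ⟨-, c⟩⟩
  · exact ⟨hr, h11', Or.inl ⟨c2, c3, fun v hv => c4 v hv (Nat.zero_le _)⟩⟩
  · exact ⟨hr, h11', Or.inr c⟩

/-- Match the vertices greedily. The number of matched vertices is added to register `16`. -/
def matchVertices : Program :=
  .block [.copyN 11 0] <| .loop (.leN 3 11) <|
    .block [.subN 11 11 3, .copyQ 3 2, .copyN 12 0] matchVertex

theorem matchVertices_runs {X : Type*} {q : DistQuery} {α β : ℕ → X} {n K : ℕ} {s : Memory}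
    (hs : Ready q α β n K s) (h16 : s.nat 16 = 0) (h8 : ∀ v, s.rat (8 + v) = 0) :
    Runs q matchVertices s (n * (n * (K * 10 + 12) + 5) + 2) fun s' => s'.nat 0 = n ∧
      (s'.nat 16 = n ↔ CanMatch α β n (fun _ => True) n) := by
  -- The `m` vertices below `m` remain. Equality in `N[16] + m ≤ n` says that no vertex has failed
  -- so far; a failure makes the inequality strict for good. Without failures, a full matching
  -- exists exactly if the remaining vertices can be matched to the unmarked ones.
  let I : ℕ → Memory → Prop := fun m s' =>
    Ready q α β n K s' ∧ s'.nat 11 = m ∧ s'.nat 16 + m ≤ n ∧ (∀ v, 0 ≤ s'.rat (8 + v)) ∧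
      (CanMatch α β n (fun _ => True) n ↔
        s'.nat 16 + m = n ∧ CanMatch α β n (fun v => s'.rat (8 + v) = 0) m)
  have key : ∀ m s', m ≤ n → I m s' → _ := Runs.countdown (q := q) (one := 3) (c := 11)
    (B := n * (K * 10 + 12) + 4)
    (p := .block [.subN 11 11 3, .copyQ 3 2, .copyN 12 0] matchVertex)
    (I := I) (fun m s' h => ⟨h.1.nat_three, h.2.1⟩)
    (by
      rintro m s' hm ⟨hr, hm11, hle, hpos, hcan⟩
      have hB : n * (K * 10 + 12) + 4 = [Op.subN 11 11 3, .copyQ 3 2, .copyN 12 0].length +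
          (n * (K * 10 + 12) + 1) := by simp; omega
      rw [hB]
      refine Runs.block ?_
      set s1 := List.foldl (Op.run q) s' [Op.subN 11 11 3, .copyQ 3 2, .copyN 12 0] with hs1
      simp only [List.foldl, Op.run, Memory.putN, Memory.putQ] at hs1
      have f11 : s1.nat 11 = m := by simp [hs1, hm11, hr.nat_three]
      have f12 : s1.nat 12 = n := by simp [hs1, hr.nat_zero]
      have fo : ∀ r, r ≠ 11 → r ≠ 12 → s1.nat r = s'.nat r := by
        intro r h h'; simp [hs1, h, h']
      have g3 : s1.rat 3 = 0 := by simp [hs1, hr.rat_two]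
      have go : ∀ r, r ≠ 3 → s1.rat r = s'.rat r := by
        intro r h; simp [hs1, h]
      clear_value s1
      clear hs1
      have hr1 : Ready q α β n K s1 := hr.congr (fun r _ h11 h12 _ _ _ _ => fo r h11 h12)
        (go 2 (by simp)) (go 4 (by simp))
      have gv : ∀ v, s1.rat (8 + v) = s'.rat (8 + v) := fun v => go _ (by omega)
      have f16 := fo 16 (by simp) (by simp)
      refine (matchVertex_runs hr1 f12 (by omega) g3 fun v => by rw [gv]; exact hpos v).mono
        le_rfl ?_
      rintro s2 ⟨hr2, k11, hcase⟩
      simp only [f11, f16, gv] at hcase k11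
      refine ⟨hr2, k11, ?_⟩
      rcases hcase with ⟨c1, c2, c3⟩ | ⟨c1, v₀, c2, c3, c4, c5⟩
      · refine ⟨by omega, fun v => by rw [c2]; exact hpos v, ?_⟩
        rw [hcan]
        constructor
        -- A matching of the remaining vertices would give a free partner for `m`, but the search
        -- found none.
        · rintro ⟨-, h⟩
          obtain ⟨v, hv, h0, he⟩ := h.exists_last
          exact absurd he (c3 v hv h0)
        · rintro ⟨h, -⟩
          omega
      · refine ⟨by omega, fun v => ?_, ?_⟩
        · rw [c5]; split_ifs
          · simp
          · exact hpos v
        · rw [hcan, canMatch_succ_iff c2 c3 c4]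
          refine and_congr (by omega) (CanMatch.congr fun v _ => ?_)
          rw [c5]
          by_cases h : v = v₀ <;> simp [h])
  have hB : n * (n * (K * 10 + 12) + 5) + 2 =
      [Op.copyN 11 0].length + (n * (n * (K * 10 + 12) + 4 + 1) + 1) := by
    rw [show n * (K * 10 + 12) + 4 + 1 = n * (K * 10 + 12) + 5 from rfl]
    simp; omega
  rw [hB]
  refine Runs.block ((key n _ le_rfl ?_).mono le_rfl ?_)
  · simp only [List.foldl, Op.run, Memory.putN]
    refine ⟨hs.congr (fun r _ h11 _ _ _ _ _ => by simp [h11]) rfl rfl, by simp [hs.nat_zero],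
      by simp [h16], by simp [h8], by simp [h16, h8]⟩
  · rintro s' ⟨hr, -, -, -, hcan⟩
    refine ⟨hr.nat_zero, ?_⟩
    -- At `m = 0` nothing remains to be matched, so only the count decides.
    rw [hcan]
    simp [CanMatch]

/-! ## The decision procedure -/

/-- Decide whether the dtgw-distance is zero. -/
def decideZero : Program :=
  -- Constants: `N[3] = 1` is the decrement, `N[17] = 8` the address of the first mark, `Q[4] = 1`
  -- the value of a mark, and `Q[2] = 0` is never written. The lengths of the two lists go to `N[8]`
  -- and `N[9]`, the lists to the even cells from `32` and the odd cells from `33` on.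
  .block [.setN 3 1, .setN 17 8, .setQ 4 1] <|
  .seq (compress .left 1 8 32) <|
  .seq (compress .right 2 9 33) <|
  .ite (.eqN 8 9)
    (.seq matchVertices (.ite (.eqN 16 0) (.op (.setN 0 1)) (.op (.setN 0 0))))
    (.op (.setN 0 0))

-- Only the nonnegativity and the zeros of the queries matter to the program, so they are left
-- arbitrary here; the metric enters later.
open Classical in
theorem decideZero_runs {X : Type*} (q : DistQuery) (n T U : ℕ) (same same' : ℕ → Prop)
    (hq : ∀ a i x b j y, 0 ≤ q a i x b j y)
    (hsame : ∀ i < T - 1, same i ↔ ∑ x ∈ range n, q .left i x .left (i + 1) x = 0)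
    (hsame' : ∀ i < U - 1, same' i ↔ ∑ x ∈ range n, q .right i x .right (i + 1) x = 0)
    (f g : ℕ → ℕ → X)
    (hfg : ∀ i ≤ T - 1, ∀ j ≤ U - 1, ∀ u < n, ∀ v < n,
      q .left i u .right j v = 0 ↔ f i u = g j v) :
    Runs q decideZero (initMemory n T U)
      ((T - 1) * (n * 4 + 12) + (U - 1) * (n * 4 + 12) +
        n * (n * ((T - 1 + 1) * 10 + 12) + 5) + 16) fun s' =>
      s'.nat 0 = if (runEnds same (T - 1) 0).length = (runEnds same' (U - 1) 0).length ∧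
        CanMatch (fun u => (runEnds same (T - 1) 0).map fun i => f i u)
          (fun v => (runEnds same' (U - 1) 0).map fun j => g j v) n (fun _ => True) n
        then 1 else 0 := by
  set A := runEnds same (T - 1) 0 with hA
  set A' := runEnds same' (U - 1) 0 with hA'
  -- Matching is only reached when both lists have the same length, so bounding one of them by `T`
  -- suffices for the running time.
  have hAlen : A.length ≤ T - 1 + 1 := by simpa using length_runEnds_le same (T - 1) 0
  have hB : (T - 1) * (n * 4 + 12) + (U - 1) * (n * 4 + 12) +
        n * (n * ((T - 1 + 1) * 10 + 12) + 5) + 16 =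
      [Op.setN 3 1, .setN 17 8, .setQ 4 1].length + (((T - 1) * (n * 4 + 12) + 4) +
        (((U - 1) * (n * 4 + 12) + 4) +
          (1 + ((n * (n * ((T - 1 + 1) * 10 + 12) + 5) + 2) + (1 + 1))))) := by
    simp; omega
  rw [hB]
  refine Runs.block (Runs.seq ?_)
  set s0 := List.foldl (Op.run q) (initMemory n T U) [Op.setN 3 1, .setN 17 8, .setQ 4 1]
    with hs0
  simp only [List.foldl, Op.run, Memory.putN, Memory.putQ] at hs0
  have z0 : s0.nat 0 = n := by simp [hs0, initMemory]
  have z1 : s0.nat 1 = T := by simp [hs0, initMemory]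
  have z2 : s0.nat 2 = U := by simp [hs0, initMemory]
  have z3 : s0.nat 3 = 1 := by simp [hs0]
  have z17 : s0.nat 17 = 8 := by simp [hs0]
  have z16 : s0.nat 16 = 0 := by simp [hs0, initMemory]
  have y4 : s0.rat 4 = 1 := by simp [hs0]
  have yo : ∀ r, r ≠ 4 → s0.rat r = 0 := by intro r h; simp [hs0, h, initMemory]
  clear_value s0
  clear hs0
  refine (compress_runs q .left (len := 1) (K := 8) (base := 32) s0 (by simp) (by simp) z3
    (yo 2 (by simp)) same (by rwa [z0, z1])).mono (by rw [z0, z1]) ?_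
  rintro s1 ⟨a1, a2, a3, a4⟩
  rw [z1, ← hA] at a1 a2
  have b0 : s1.nat 0 = n := by rw [a3 0 (by simp), z0]
  have b2 : s1.nat 2 = U := by rw [a3 2 (by simp), z2]
  refine Runs.seq ((compress_runs q .right (len := 2) (K := 9) (base := 33) s1 (by simp) (by simp)
    (by rw [a3 3 (by simp), z3]) (by rw [a4 2 (by simp), yo 2 (by simp)]) same'
    (by rwa [b0, b2])).mono (by rw [b0, b2]) ?_)
  rintro s2 ⟨c1, c2, c3, c4⟩
  rw [b2, ← hA'] at c1 c2
  have d1 : Stored s2.nat 32 A := a1.congr fun i _ => c3 _ (Or.inr ⟨by omega, by omega, by omega⟩)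
  have d2 : s2.nat 8 = A.length := by rw [c3 8 (Or.inr ⟨by omega, by omega, by omega⟩), a2]
  refine Runs.ite ?_ ?_
  · intro hc
    have hlen : A.length = A'.length := by rw [← d2, ← c2]; exact hc
    have hready : Ready q (fun u => A.map fun i => f i u) (fun v => A'.map fun j => g j v) n
        A.length s2 := by
      refine ⟨by rw [c3 0 (by simp), b0], by rw [c3 3 (by simp), a3 3 (by simp), z3], d2, ?_, ?_,
        ?_, fun u v => sum_nonneg fun i _ => hq _ _ _ _ _ _, fun u hu v hv => ?_⟩
      · rw [c3 17 (Or.inr ⟨by omega, by omega, by omega⟩),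
          a3 17 (Or.inr ⟨by omega, by omega, by omega⟩), z17]
      · rw [c4 2 (by simp), a4 2 (by simp), yo 2 (by simp)]
      · rw [c4 4 (by simp), a4 4 (by simp), y4]
      · rw [sum_eq_zero_iff_of_nonneg fun i _ => hq _ _ _ _ _ _]
        simp only [mem_range]
        -- Vanishing of all the stored distances becomes an entrywise relation between the lists of
        -- layers, and then equality of the two colours.
        rw [Stored.forall_iff (R := fun i j => q .left i u .right j v = 0) hlen d1 c1,
          ← List.forall₂_eq_eq_eq, List.forall₂_map_left_iff, List.forall₂_map_right_iff,
          List.forall₂_iff_get, List.forall₂_iff_get]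
        refine and_congr_right fun _ => forall_congr' fun i => forall₂_congr fun hi hi' => ?_
        exact hfg _ (le_of_mem_runEnds (List.get_mem _ _)) _ (le_of_mem_runEnds (List.get_mem _ _))
          u hu v hv
    refine Runs.seq ((matchVertices_runs hready ?_ ?_).mono ?_ ?_)
    · rw [c3 16 (Or.inr ⟨by omega, by omega, by omega⟩),
        a3 16 (Or.inr ⟨by omega, by omega, by omega⟩), z16]
    · intro v
      rw [c4 _ (by omega), a4 _ (by omega), yo _ (by omega)]
    · gcongr
    · rintro s3 ⟨e0, e16⟩
      refine Runs.ite (fun h => Runs.op ?_) (fun h => Runs.op ?_)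
      · have : s3.nat 16 = n := by rw [← e0]; exact h
        simp [Op.run, Memory.putN, hlen, e16.1 this]
      · have : s3.nat 16 ≠ n := by rw [← e0]; exact h
        simp [Op.run, Memory.putN, mt e16.2 this]
  · intro hc
    have hlen : A.length ≠ A'.length := by rw [← d2, ← c2]; exact hc
    refine (Runs.op ?_).mono (by omega) fun _ h => h
    simp [Op.run, Memory.putN, hlen]

/-! ## When the dtgw-distance is zero -/

theorem IsMetric.nonneg {X : Type*} {d : X → X → ℚ} (hd : IsMetric d) (x y : X) : 0 ≤ d x y := by
  have h1 := hd.triangle x y x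
  rw [(hd.eq_zero_iff x x).2 rfl, hd.symm y x] at h1
  linarith

theorem inf'_eq_zero_iff {ι : Type*} {s : Finset ι} (hs : s.Nonempty) {f : ι → ℚ}
    (hf : ∀ i ∈ s, 0 ≤ f i) : s.inf' hs f = 0 ↔ ∃ i ∈ s, f i = 0 := by
  constructor
  · intro h
    obtain ⟨i, hi, he⟩ := exists_mem_eq_inf' hs f
    exact ⟨i, hi, he ▸ h⟩
  · rintro ⟨i, hi, he⟩
    exact le_antisymm (he ▸ inf'_le f hi) (le_inf' hs f hf)

/-- The sequence of signature columns, with `none` for the missing layers. -/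
def TemporalGraph.columns {V : Type*} {k n : ℕ} (G : TemporalGraph V k) (e : Fin n ≃ V) (i : ℕ) :
    Fin n → Option (Fin k → ℚ) := fun u => G.sigAt e i u

theorem TemporalGraph.sigAt_of_lt {V : Type*} {k n : ℕ} (G : TemporalGraph V k) (e : Fin n ≃ V) {i x : ℕ}
    (hi : i < G.lifetime) (hx : x < n) :
    G.sigAt e i x = some ((G.layer ⟨i, hi⟩).sig (e ⟨x, hx⟩)) := by
  simp [TemporalGraph.sigAt, hi, hx]

section

variable {V W : Type*} [Fintype V] [Fintype W] {k : ℕ} {d : (Fin k → ℚ) → (Fin k → ℚ) → ℚ}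

/-- There are as many pairs as vertices on either side, and the coordinates are distinct, so every
vertex is used. -/
theorem IsVertexMapping.surjective {M : Finset (V × W)} (hM : IsVertexMapping M)
    (h : Fintype.card V = Fintype.card W) :
    (∀ v, ∃ w, (v, w) ∈ M) ∧ ∀ w, ∃ v, (v, w) ∈ M := by
  classical
  obtain ⟨h1, h2, h3⟩ := hM
  have i1 : M.image Prod.fst = univ := by
    rw [← card_eq_iff_eq_univ, card_image_of_injOn fun x hx y hy => h2 x hx y hy, h1, h, min_self]
  have i2 : M.image Prod.snd = univ := by
    rw [← card_eq_iff_eq_univ, card_image_of_injOn fun x hx y hy => h3 x hx y hy, h1, h, min_self]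
  refine ⟨fun v => ?_, fun w => ?_⟩
  · have : v ∈ M.image Prod.fst := i1 ▸ mem_univ v
    simpa using this
  · have : w ∈ M.image Prod.snd := i2 ▸ mem_univ w
    simpa using this

theorem mappingCost_eq_sum {G : SigGraph V k} {H : SigGraph W k} {M : Finset (V × W)}
    (hM : IsVertexMapping M) (h : Fintype.card V = Fintype.card W) :
    mappingCost d G H M = ∑ x ∈ M, d (G.sig x.1) (H.sig x.2) := by
  classical
  obtain ⟨h1, h2⟩ := hM.surjective h
  rw [mappingCost, sum_eq_zero (s := univ \ M.image Prod.fst),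
    sum_eq_zero (s := univ \ M.image Prod.snd), add_zero, add_zero]
  · intro w hw
    obtain ⟨v, hv⟩ := h2 w
    exact absurd (mem_image_of_mem Prod.snd hv) (by simpa using hw)
  · intro v hv
    obtain ⟨w, hw⟩ := h1 v
    exact absurd (mem_image_of_mem Prod.fst hw) (by simpa using hv)

theorem dtgw_eq_zero_iff {n : ℕ} (e : Fin n ≃ V) (e' : Fin n ≃ W) (hd : IsMetric d)
    (G : TemporalGraph V k) (H : TemporalGraph W k) :
    dtgw d G H = 0 ↔ ∃ σ : Equiv.Perm (Fin n), ∃ p, IsWarpingPath p ∧ ∀ x ∈ p, ∀ u,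
      (G.layer x.1).sig (e u) = (H.layer x.2).sig (e' (σ u)) := by
  classical
  have hV : Fintype.card V = n := by simpa using (Fintype.card_congr e).symm
  have hW : Fintype.card W = n := by simpa using (Fintype.card_congr e').symm
  have hVW : Fintype.card V = Fintype.card W := by rw [hV, hW]
  -- Deletion costs may be negative, but they do not occur for equally many vertices.
  have hnn : ∀ M ∈ vertexMappings V W, ∀ i j, 0 ≤ mappingCost d (G.layer i) (H.layer j) M := by
    intro M hM i j
    rw [mappingCost_eq_sum (by simpa [vertexMappings] using hM) hVW]
    exact sum_nonneg fun x _ => hd.nonneg _ _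
  rw [dtgw, inf'_eq_zero_iff _ fun M hM => le_inf' _ _ fun p _ => sum_nonneg fun x _ => hnn M hM _ _]
  have hstep : ∀ M ∈ vertexMappings V W, ((warpingPaths G.lifetime H.lifetime).inf'
      (warpingPaths_nonempty G.lifetime_pos H.lifetime_pos) fun p =>
        ∑ x ∈ p, mappingCost d (G.layer x.1) (H.layer x.2) M) = 0 ↔
      ∃ p, IsWarpingPath p ∧ ∀ x ∈ p, ∀ y ∈ M,
        (G.layer x.1).sig y.1 = (H.layer x.2).sig y.2 := by
    intro M hM
    rw [inf'_eq_zero_iff _ fun p _ => sum_nonneg fun x _ => hnn M hM _ _]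
    simp only [warpingPaths, mem_filter, mem_univ, true_and]
    refine exists_congr fun p => and_congr_right fun _ => ?_
    rw [sum_eq_zero_iff_of_nonneg fun x _ => hnn M hM _ _]
    refine forall₂_congr fun x _ => ?_
    rw [mappingCost_eq_sum (by simpa [vertexMappings] using hM) hVW,
      sum_eq_zero_iff_of_nonneg fun x _ => hd.nonneg _ _]
    simp only [hd.eq_zero_iff]
  constructor
  · rintro ⟨M, hM, h⟩
    obtain ⟨p, hp, h⟩ := (hstep M hM).1 h
    have hM' : IsVertexMapping M := by simpa [vertexMappings] using hM
    choose f hf using (hM'.surjective hVW).1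
    -- Read in the numberings `e` and `e'`, the vertex mapping is an injective self-map of `Fin n`,
    -- hence a permutation.
    have hinj : Function.Injective fun u => e'.symm (f (e u)) := by
      intro u v huv
      have := hM'.2.2 _ (hf (e u)) _ (hf (e v)) (e'.symm.injective huv)
      exact e.injective (Prod.ext_iff.1 this).1
    refine ⟨Equiv.ofBijective _ (Finite.injective_iff_bijective.1 hinj), p, hp, fun x hx u => ?_⟩
    simpa using h x hx _ (hf (e u))
  · rintro ⟨σ, p, hp, h⟩
    have hM : univ.image (fun u => (e u, e' (σ u))) ∈ vertexMappings V W := by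
      simp only [vertexMappings, mem_filter, mem_univ, true_and, IsVertexMapping]
      refine ⟨?_, ?_, ?_⟩
      · rw [card_image_of_injective _ fun a b hab => e.injective (Prod.ext_iff.1 hab).1]
        simp [hV, hW]
      · simp
      · simp
    refine ⟨_, hM, (hstep _ hM).2 ⟨p, hp, fun x hx y hy => ?_⟩⟩
    obtain ⟨u, -, rfl⟩ := mem_image.1 hy
    exact h x hx u

theorem dtgw_eq_zero_iff_canMatch {n : ℕ} (e : Fin n ≃ V) (e' : Fin n ≃ W) (hd : IsMetric d)
    (G : TemporalGraph V k) (H : TemporalGraph W k) :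
    dtgw d G H = 0 ↔
      (runEnds (fun i => G.columns e i = G.columns e (i + 1)) (G.lifetime - 1) 0).length =
        (runEnds (fun i => H.columns e' i = H.columns e' (i + 1)) (H.lifetime - 1) 0).length ∧
      CanMatch
        (fun u => (runEnds (fun i => G.columns e i = G.columns e (i + 1))
          (G.lifetime - 1) 0).map fun i => G.sigAt e i u)
        (fun v => (runEnds (fun i => H.columns e' i = H.columns e' (i + 1))
          (H.lifetime - 1) 0).map fun j => H.sigAt e' j v) n (fun _ => True) n := by
  rw [dtgw_eq_zero_iff e e' hd, canMatch_iff_exists_perm, ← exists_and_left]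
  refine exists_congr fun σ => ?_
  have h1 : (∃ p : Finset (Fin G.lifetime × Fin H.lifetime), IsWarpingPath p ∧ ∀ x ∈ p, ∀ u,
      (G.layer x.1).sig (e u) = (H.layer x.2).sig (e' (σ u))) ↔
      ∃ p : Finset (Fin G.lifetime × Fin H.lifetime), IsWarpingPath p ∧
        ∀ x ∈ p, G.columns e x.1 = H.columns e' x.2 ∘ σ := by
    refine exists_congr fun p => and_congr_right fun _ => forall₂_congr fun x _ => ?_
    rw [funext_iff]
    refine forall_congr' fun u => ?_
    simp [TemporalGraph.columns, TemporalGraph.sigAt_of_lt]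
  -- Composing with the bijection `σ` is injective, so the runs of the right graph are the same for
  -- every `σ`. This makes it possible to shorten before matching.
  have h2 : (fun i => H.columns e' i ∘ σ = H.columns e' (i + 1) ∘ σ) =
      fun i => H.columns e' i = H.columns e' (i + 1) := by
    funext i
    rw [σ.surjective.injective_comp_right.eq_iff]
  rw [h1, exists_isWarpingPath_iff (h := fun j => H.columns e' j ∘ σ) G.lifetime_pos
    H.lifetime_pos, h2]
  set A := runEnds (fun i => G.columns e i = G.columns e (i + 1)) (G.lifetime - 1) 0
  set B := runEnds (fun i => H.columns e' i = H.columns e' (i + 1)) (H.lifetime - 1) 0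
  constructor
  · intro h
    refine ⟨by simpa using congrArg List.length h, fun u => ?_⟩
    simpa [TemporalGraph.columns, Function.comp_def] using congrArg (List.map fun c => c u) h
  -- Transposition: equal colours at every vertex, together with equal lengths, give equal tuples at
  -- every remaining layer.
  · rintro ⟨hl, h⟩
    refine List.ext_getElem (by simpa using hl) fun i hi hi' => ?_
    funext u
    rw [List.length_map] at hi hi'
    have := List.getElem_of_eq (h u) (i := i) (by simpa using hi)
    simpa [TemporalGraph.columns] using this

end

end DTGW

/-! ### Correctness and running time of the decision procedure -/

theorem mainTheorem2 :
    ∃ (P : DTGW.Program) (C : ℕ),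
      ∀ (n k : ℕ) (V : Type*) (W : Type*) [Fintype V] [Fintype W]
        (e : Fin n ≃ V) (e' : Fin n ≃ W)
        (d : (Fin k → ℚ) → (Fin k → ℚ) → ℚ) (_ : DTGW.IsMetric d)
        (G : DTGW.TemporalGraph V k) (H : DTGW.TemporalGraph W k),
        ∃ (t : ℕ) (s : DTGW.Memory),
          DTGW.Exec (DTGW.distQuery d G e H e') P
            (DTGW.initMemory n G.lifetime H.lifetime) t s ∧
          s.nat 0 = (if DTGW.dtgw d G H = 0 then 1 else 0) ∧
          (1 ≤ n → t ≤ C * (n ^ 2 * (G.lifetime + H.lifetime) + n ^ 3)) := by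
  -- For `n ≥ 1`, `4n + 12 ≤ 16n^2` and `12n^2 + 5n + 16 ≤ 33n^2`. The total is at most `n^2 (26T +
  -- 16U + 33)`, and `26 + 33 = 59` suffices because `T ≥ 1`.
  refine ⟨DTGW.decideZero, 59, ?_⟩
  intro n k V W _ _ e e' d hd G H
  have hT := G.lifetime_pos
  have hU := H.lifetime_pos
  -- Queries out of range return `0`, so nonnegativity holds for all arguments.
  have hq : ∀ a i x b j y, 0 ≤ DTGW.distQuery d G e H e' a i x b j y := by
    intro a i x b j y
    simp only [DTGW.distQuery]
    split
    · exact hd.nonneg _ _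
    · exact le_rfl
  obtain ⟨t, s, h1, h2, h3⟩ := DTGW.decideZero_runs (DTGW.distQuery d G e H e') n G.lifetime
    H.lifetime (fun i => G.columns e i = G.columns e (i + 1))
    (fun i => H.columns e' i = H.columns e' (i + 1)) hq
    (fun i hi => by
      have hi' : i < G.lifetime := by omega
      have hi'' : i + 1 < G.lifetime := by omega
      rw [Finset.sum_eq_zero_iff_of_nonneg fun x _ => hq _ _ _ _ _ _, funext_iff, Fin.forall_iff]
      simp only [Finset.mem_range]
      refine forall₂_congr fun x hx => ?_
      simp [DTGW.TemporalGraph.columns, DTGW.distQuery, DTGW.TemporalGraph.sigAt_of_lt, hi', hi'',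
        hx, hd.eq_zero_iff])
    (fun i hi => by
      have hi' : i < H.lifetime := by omega
      have hi'' : i + 1 < H.lifetime := by omega
      rw [Finset.sum_eq_zero_iff_of_nonneg fun x _ => hq _ _ _ _ _ _, funext_iff, Fin.forall_iff]
      simp only [Finset.mem_range]
      refine forall₂_congr fun x hx => ?_
      simp [DTGW.TemporalGraph.columns, DTGW.distQuery, DTGW.TemporalGraph.sigAt_of_lt, hi', hi'',
        hx, hd.eq_zero_iff])
    (G.sigAt e) (H.sigAt e')
    (fun i hi j hj u hu v hv => by
      have hi' : i < G.lifetime := by omega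
      have hj' : j < H.lifetime := by omega
      simp [DTGW.distQuery, DTGW.TemporalGraph.sigAt_of_lt, hi', hj', hu, hv, hd.eq_zero_iff])
  refine ⟨t, s, h1, ?_, fun hn => h2.trans ?_⟩
  · rw [h3]
    classical exact if_congr (DTGW.dtgw_eq_zero_iff_canMatch e e' hd G H).symm rfl rfl
  · obtain ⟨T, hT'⟩ : ∃ T, G.lifetime = T + 1 := ⟨G.lifetime - 1, by omega⟩
    obtain ⟨U, hU'⟩ : ∃ U, H.lifetime = U + 1 := ⟨H.lifetime - 1, by omega⟩
    -- With `n`, `T` and `U` written as successors, all truncated subtractions disappear and the two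
    -- polynomials can be compared coefficient by coefficient.
    obtain ⟨m, rfl⟩ : ∃ m, n = m + 1 := ⟨n - 1, by omega⟩
    rw [hT', hU']
    simp only [Nat.add_sub_cancel]
    ring_nf
    linarith [Nat.zero_le (m * T), Nat.zero_le (m * U), Nat.zero_le (m ^ 2 * T),
      Nat.zero_le (m ^ 2 * U), Nat.zero_le (m ^ 2), Nat.zero_le (m ^ 3)]
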